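/- Let $(M,g)$ be a compact Kähler surface, that is, a compact complex manifold $M$ of complex dimension $2$, with complex structure $J$, together with a smooth Riemannian metric $g$ such that $g(JX,JY)=g(X,Y)$ and such that the form $\omega(X,Y)=g(JX,Y)$ is closed. Suppose that $g$ is Ricci-flat. For $p\in M$ let $H_{\max}(p)$ (respectively $H_{\min}(p)$) denote the maximum (respectively the minimum) of the holomorphic sectional curvatures at $p$, that is, of the sectional curvatures $K(u,Ju)$ over all non-zero $u\in T_pM$. If there is a constant $c$ with $0\le c<\frac{1+\sqrt3}{2}$ such that $$H_{\max}(p)\ \le\ -c\,H_{\min}(p)\qquad\text{for all } p\in M,$$ then $(M,g)$ is flat, that is, its Riemann curvature tensor vanishes identically. -/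

import Mathlib

open Manifold
open scoped ContDiff Bundle

noncomputable section

/-! ### Riemannian geometry in a chart

A Riemannian metric on an open subset of a finite-dimensional real vector space `E` is a function
`G` with values in the bilinear forms on `E`; all notions below depend only on the germ of `G` at
the point `y`. -/

section Local

variable {E : Type*} [NormedAddCommGroup E] [NormedSpace ℝ E]

/-- Twice the Christoffel symbols of the first kind, as a linear form in `w`:
`w ↦ (D_u G)(v, w) + (D_v G)(u, w) - (D_w G)(u, v)`. -/
def christoffelForm (G : E → E →L[ℝ] E →L[ℝ] ℝ) (y u v : E) : E →L[ℝ] ℝ :=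
  fderiv ℝ G y u v + fderiv ℝ G y v u - ((fderiv ℝ G y).flip u).flip v

theorem christoffelForm_apply (G : E → E →L[ℝ] E →L[ℝ] ℝ) (y u v w : E) :
    christoffelForm G y u v w =
      fderiv ℝ G y u v w + fderiv ℝ G y v u w - fderiv ℝ G y w u v := rfl

/-- The Christoffel symbols of the Levi-Civita connection of `G`: `Γ(u, v)` is the vector with
`G(Γ(u, v), w) = ½ ((D_u G)(v, w) + (D_v G)(u, w) - (D_w G)(u, v))` for all `w`. -/
def christoffel (G : E → E →L[ℝ] E →L[ℝ] ℝ) (y u v : E) : E :=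
  (G y).inverse ((1 / 2 : ℝ) • christoffelForm G y u v)

/-- The Riemann curvature `R(u, v) w = ∇_u ∇_v w - ∇_v ∇_u w`, for constant vector fields
`u`, `v`, `w`. -/
def curvature (G : E → E →L[ℝ] E →L[ℝ] ℝ) (y u v w : E) : E :=
  fderiv ℝ (fun x => christoffel G x v w) y u - fderiv ℝ (fun x => christoffel G x u w) y v
    + christoffel G y u (christoffel G y v w) - christoffel G y v (christoffel G y u w)

/-- The Ricci curvature `Ric(v, w) = tr (u ↦ R(u, v) w)`, the trace being computed in some
basis of `E`. -/
def ricci [FiniteDimensional ℝ E] (G : E → E →L[ℝ] E →L[ℝ] ℝ) (y v w : E) : ℝ :=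
  ∑ i, (Module.finBasis ℝ E).coord i (curvature G y (Module.finBasis ℝ E i) v w)

/-- The sectional curvature of the plane spanned by `u` and `v`. -/
def sectional (G : E → E →L[ℝ] E →L[ℝ] ℝ) (y u v : E) : ℝ :=
  G y (curvature G y u v v) u / (G y u u * G y v v - G y u v ^ 2)

end Local

/-! ### Metrics on a complex manifold -/

section Global

variable {E : Type*} [NormedAddCommGroup E] [NormedSpace ℂ E]

/-- Multiplication by `i`, as a real linear map. -/
def mulI : E →L[ℝ] E := Complex.I • ContinuousLinearMap.id ℝ E

/-- The real manifold underlying a complex manifold. -/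
instance isManifold_real_of_complex {M : Type*} [TopologicalSpace M] [ChartedSpace E M]
    [IsManifold 𝓘(ℂ, E) ω M] : IsManifold 𝓘(ℝ, E) ω M := by
  refine isManifold_of_contDiffOn 𝓘(ℝ, E) ω M fun e e' he he' => ?_
  have h := HasGroupoid.compatible (G := contDiffGroupoid ω 𝓘(ℂ, E)) he he'
  rw [contDiffGroupoid, mem_groupoid_of_pregroupoid] at h
  exact ContDiffOn.restrict_scalars ℝ h.1

variable {M : Type*} [TopologicalSpace M] [ChartedSpace E M] [IsManifold 𝓘(ℂ, E) ω M]

variable (E M) in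
/-- Smooth Riemannian metrics on the real manifold underlying a complex manifold. -/
abbrev SmoothMetric : Type _ :=
  Bundle.ContMDiffRiemannianMetric 𝓘(ℝ, E) ∞ E (fun p : M => TangentSpace 𝓘(ℝ, E) p)

/-- The metric `g` read in the chart `e`, that is, the pullback of `g` by `e.symm`. -/
def localMetric (g : SmoothMetric E M) (e : OpenPartialHomeomorph M E) (y : E) :
    E →L[ℝ] E →L[ℝ] ℝ :=
  let b : E →L[ℝ] E →L[ℝ] ℝ := g.inner (e.symm y)
  let d : E →L[ℝ] E := mfderiv 𝓘(ℝ, E) 𝓘(ℝ, E) e.symm y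
  b.bilinearComp d d

theorem localMetric_apply (g : SmoothMetric E M) (e : OpenPartialHomeomorph M E) (y u v : E) :
    localMetric g e y u v = g.inner (e.symm y) (mfderiv 𝓘(ℝ, E) 𝓘(ℝ, E) e.symm y u)
      (mfderiv 𝓘(ℝ, E) 𝓘(ℝ, E) e.symm y v) := rfl

/-- `g` is Kähler: it is invariant under the complex structure `J`, which is multiplication by `i`
in the holomorphic charts, and the Kähler form `ω(u, v) = g(J u, v)` is closed, that is,
`dω(u, v, w) = (D_u ω)(v, w) - (D_v ω)(u, w) + (D_w ω)(u, v)` vanishes. -/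
structure IsKahler (g : SmoothMetric E M) : Prop where
  hermitian : ∀ e ∈ atlas E M, ∀ y ∈ e.target, ∀ u v : E,
    localMetric g e y (mulI u) (mulI v) = localMetric g e y u v
  closed : ∀ e ∈ atlas E M, ∀ y ∈ e.target, ∀ u v w : E,
    fderiv ℝ (localMetric g e) y u (mulI v) w - fderiv ℝ (localMetric g e) y v (mulI u) w
      + fderiv ℝ (localMetric g e) y w (mulI u) v = 0

/-- The curvature tensor at `p`. Tangent vectors at `p` are read in the preferred holomorphic
chart at `p`, as in the definition of `TangentSpace`. -/
def curvatureAt (g : SmoothMetric E M) (p : M) (u v w : E) : E :=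
  curvature (localMetric g (chartAt E p)) (chartAt E p p) u v w

/-- The Ricci tensor at `p`. -/
def ricciAt [FiniteDimensional ℂ E] (g : SmoothMetric E M) (p : M) (v w : E) : ℝ :=
  ricci (localMetric g (chartAt E p)) (chartAt E p p) v w

/-- The holomorphic sectional curvature at `p` of the complex line spanned by `u`, that is, the
sectional curvature of the real plane spanned by `u` and `J u`. -/
def holSectionalAt (g : SmoothMetric E M) (p : M) (u : E) : ℝ :=
  sectional (localMetric g (chartAt E p)) (chartAt E p p) u (mulI u)

/-- The maximum of the holomorphic sectional curvatures at `p`. -/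
def Hmax (g : SmoothMetric E M) (p : M) : ℝ :=
  sSup {h | ∃ u : E, u ≠ 0 ∧ holSectionalAt g p u = h}

/-- The minimum of the holomorphic sectional curvatures at `p`. -/
def Hmin (g : SmoothMetric E M) (p : M) : ℝ :=
  sInf {h | ∃ u : E, u ≠ 0 ∧ holSectionalAt g p u = h}

/-- The Ricci tensor vanishes identically. -/
def IsRicciFlat [FiniteDimensional ℂ E] (g : SmoothMetric E M) : Prop :=
  ∀ (p : M) (v w : E), ricciAt g p v w = 0

/-- The Riemann curvature tensor vanishes identically. -/
def IsFlat (g : SmoothMetric E M) : Prop := ∀ (p : M) (u v w : E), curvatureAt g p u v w = 0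

end Global

end

/-! The proof is a maximum principle for the smallest holomorphic sectional curvature `m` over all
points and all complex lines, which is attained because `M` is compact (`exists_global_min`).

If `m ≥ 0`, then pinching gives `Hmax ≤ -c * Hmin ≤ 0`, so the holomorphic sectional curvature
vanishes everywhere, and in a Kähler surface with zero Ricci tensor this forces the curvature to
vanish (`curvature_eq_zero_of_holomorphic`).

Suppose `m < 0`, attained at `x` on the line of a unit vector. In holomorphic coordinates with `Γ(x)
= 0` (`exists_normal_coordinates`) take a basis `e` that is unitary at `x`, with `e 0` that vector,
and extend `e 0` as a constant field. The function `R(e₀, ie₀, ie₀, e₀) - m |e₀|⁴` is nonnegative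
and vanishes at `x`, so its complex Laplacian `∑ ∂ₖ∂̄ₖ` is nonnegative there. The Laplacian of
`|e₀|⁴` is a Ricci trace, hence zero (`laplacian_sq`). The Laplacian of the curvature term is, by
the Kähler symmetries and Ricci-flatness, `-2` times a quadratic reaction term in the curvature
(`laplacian_dbar_christoffel`).

A Ricci-flat curvature tensor in a unitary frame reduces to a real number `a` and complex numbers
`β`, `γ` (`exists_components`). Here `a = -m/2 > 0`. Minimality forces `β = 0`, the reaction term
becomes `3a² - |γ|²`, and the pinching gives `|γ| ≤ (2c - 1)a`. Since `(2c - 1)² < 3` exactly when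
`c` lies between `(1 - √3)/2` and `(1 + √3)/2`, the reaction term is positive (`reaction_pos`),
which contradicts the sign of the Laplacian.

The curvature enters throughout as `∂̄Γ` (`dbarChristoffel`), and the fourth-order computation is
formal, with commuting derivations on an algebra of smooth functions. -/

open scoped Topology

set_option maxSynthPendingDepth 3

noncomputable section

/-! ### Levi-Civita connection and curvature in a chart, and their naturality. -/

section Riemann

variable {E : Type*} [NormedAddCommGroup E] [NormedSpace ℝ E]

/-- `G` is a smooth Riemannian metric on the open set `U`. -/
structure IsMetricOn (G : E → E →L[ℝ] E →L[ℝ] ℝ) (U : Set E) : Prop where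
  isOpen : IsOpen U
  smooth : ContDiffOn ℝ ∞ G U
  symm : ∀ x ∈ U, ∀ u v, G x u v = G x v u
  pos : ∀ x ∈ U, ∀ u, u ≠ 0 → 0 < G x u u

/-- The Christoffel symbols as a function with values in the bilinear maps. -/
def christoffelCLM (G : E → E →L[ℝ] E →L[ℝ] ℝ) (y : E) : E →L[ℝ] E →L[ℝ] E :=
  (1 / 2 : ℝ) • (ContinuousLinearMap.compL ℝ E (E →L[ℝ] ℝ) E (G y).inverse).comp
    (fderiv ℝ G y + (fderiv ℝ G y).flip -
      ((ContinuousLinearMap.flipₗᵢ ℝ E E ℝ).toContinuousLinearEquiv :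
        (E →L[ℝ] E →L[ℝ] ℝ) →L[ℝ] (E →L[ℝ] E →L[ℝ] ℝ)).comp (fderiv ℝ G y).flip)

theorem christoffelCLM_apply (G : E → E →L[ℝ] E →L[ℝ] ℝ) (y u v : E) :
    christoffelCLM G y u v = christoffel G y u v := by
  rw [christoffel, map_smul]
  rfl

theorem contDiffOn_fderiv_of_isOpen {F : Type*} [NormedAddCommGroup F] [NormedSpace ℝ F]
    {f : E → F} {U : Set E} (hU : IsOpen U) (hf : ContDiffOn ℝ ∞ f U) :
    ContDiffOn ℝ ∞ (fderiv ℝ f) U :=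
  hf.fderiv_of_isOpen hU (by simp)

theorem fderiv_comm {F : Type*} [NormedAddCommGroup F] [NormedSpace ℝ F]
    {f : E → F} {U : Set E} (hU : IsOpen U) (hf : ContDiffOn ℝ ∞ f U) {x : E} (hx : x ∈ U)
    (u v : E) : fderiv ℝ (fderiv ℝ f) x u v = fderiv ℝ (fderiv ℝ f) x v u :=
  ((hf.contDiffAt (hU.mem_nhds hx)).isSymmSndFDerivAt
    (by simpa using WithTop.coe_le_coe.2 (le_top : (2 : ℕ∞) ≤ ⊤))).eq u v

theorem differentiableAt_of_contDiffOn {F : Type*} [NormedAddCommGroup F] [NormedSpace ℝ F]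
    {f : E → F} {U : Set E} (hU : IsOpen U) (hf : ContDiffOn ℝ ∞ f U) {x : E} (hx : x ∈ U) :
    DifferentiableAt ℝ f x :=
  (hf.contDiffAt (hU.mem_nhds hx)).differentiableAt (by simp)

theorem fderiv_eq_of_eqOn {F : Type*} [NormedAddCommGroup F] [NormedSpace ℝ F]
    {f g : E → F} {U : Set E} (hU : IsOpen U) (h : Set.EqOn f g U) {x : E} (hx : x ∈ U) :
    fderiv ℝ f x = fderiv ℝ g x :=
  (h.eventuallyEq_of_mem (hU.mem_nhds hx)).fderiv_eq

theorem fderiv_apply_const {F : Type*} [NormedAddCommGroup F] [NormedSpace ℝ F]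
    {B : E → E →L[ℝ] F} {x : E} (hB : DifferentiableAt ℝ B x) (a b : E) :
    fderiv ℝ (fun t => B t b) x a = fderiv ℝ B x a b := by
  rw [fderiv_clm_apply hB (by fun_prop)]
  simp

theorem fderiv_apply_const₂ {F : Type*} [NormedAddCommGroup F] [NormedSpace ℝ F]
    {B : E → E →L[ℝ] E →L[ℝ] F} {x : E} (hB : DifferentiableAt ℝ B x) (a b c : E) :
    fderiv ℝ (fun t => B t b c) x a = fderiv ℝ B x a b c := by
  rw [fderiv_apply_const (B := fun t => B t b) (by fun_prop), fderiv_apply_const hB]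

theorem fderiv_apply₂ {F : Type*} [NormedAddCommGroup F] [NormedSpace ℝ F]
    {B : E → E →L[ℝ] E →L[ℝ] F} {y z : E → E} {x : E} (hB : DifferentiableAt ℝ B x)
    (hy : DifferentiableAt ℝ y x) (hz : DifferentiableAt ℝ z x) (a : E) :
    fderiv ℝ (fun t => B t (y t) (z t)) x a =
      fderiv ℝ B x a (y x) (z x) + B x (fderiv ℝ y x a) (z x) + B x (y x) (fderiv ℝ z x a) := by
  rw [fderiv_clm_apply (c := fun t => B t (y t)) (by fun_prop) hz, add_apply,
    ContinuousLinearMap.flip_apply, fderiv_clm_apply hB hy]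
  simp
  abel

variable {G : E → E →L[ℝ] E →L[ℝ] ℝ} {U : Set E}

namespace IsMetricOn

theorem differentiableAt (h : IsMetricOn G U) {x : E} (hx : x ∈ U) : DifferentiableAt ℝ G x :=
  differentiableAt_of_contDiffOn h.isOpen h.smooth hx

theorem eq_of_forall (h : IsMetricOn G U) {x : E} (hx : x ∈ U) {a b : E}
    (hab : ∀ w, G x a w = G x b w) : a = b := by
  by_contra hne
  have h1 := h.pos x hx (a - b) (sub_ne_zero.2 hne)
  rw [map_sub (G x), sub_apply, hab, sub_self] at h1
  exact lt_irrefl _ h1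

theorem fderiv_symm (h : IsMetricOn G U) {x : E} (hx : x ∈ U) (a u v : E) :
    fderiv ℝ G x a u v = fderiv ℝ G x a v u := by
  have h1 : Set.EqOn (fun y => G y u v) (fun y => G y v u) U := fun y hy => h.symm y hy u v
  have h2 := fderiv_eq_of_eqOn h.isOpen h1 hx
  have hd := h.differentiableAt hx
  rw [← fderiv_apply_const₂ hd, ← fderiv_apply_const₂ hd, h2]

variable [FiniteDimensional ℝ E]

/-- Positivity makes `G x` injective, and `E` and its dual have the same dimension. Hence `(G
y).inverse` in `christoffel` is a true inverse, not the default value. -/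
theorem isInvertible (h : IsMetricOn G U) {x : E} (hx : x ∈ U) : (G x).IsInvertible := by
  have hinj : Function.Injective (G x : E →ₗ[ℝ] (E →L[ℝ] ℝ)) := by
    intro a b hab
    exact h.eq_of_forall hx fun w => congrArg (fun l : E →L[ℝ] ℝ => l w) hab
  have hfr : Module.finrank ℝ E = Module.finrank ℝ (E →L[ℝ] ℝ) := by
    rw [← LinearEquiv.finrank_eq (LinearMap.toContinuousLinearMap (𝕜 := ℝ) (E := E) (F' := ℝ))]
    exact (Subspace.dual_finrank_eq (K := ℝ) (V := E)).symm
  refine ⟨(LinearEquiv.ofInjectiveOfFinrankEq _ hinj hfr).toContinuousLinearEquiv, ?_⟩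
  ext a b
  rfl

theorem apply_christoffel (h : IsMetricOn G U) {x : E} (hx : x ∈ U) (u v w : E) :
    G x (christoffel G x u v) w =
      (fderiv ℝ G x u v w + fderiv ℝ G x v u w - fderiv ℝ G x w u v) / 2 := by
  obtain ⟨e, he⟩ := h.isInvertible hx
  rw [christoffel, ← he, ContinuousLinearMap.inverse_equiv]
  simp [christoffelForm_apply]
  ring

theorem christoffel_eq (h : IsMetricOn G U) {x : E} (hx : x ∈ U) {u v z : E}
    (hz : ∀ w, G x z w = (fderiv ℝ G x u v w + fderiv ℝ G x v u w - fderiv ℝ G x w u v) / 2) :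
    christoffel G x u v = z :=
  h.eq_of_forall hx fun w => by rw [h.apply_christoffel hx, hz]

theorem christoffel_symm (h : IsMetricOn G U) {x : E} (hx : x ∈ U) (u v : E) :
    christoffel G x u v = christoffel G x v u := by
  refine h.christoffel_eq hx fun w => ?_
  rw [h.apply_christoffel hx, h.fderiv_symm hx w]
  ring

/-- The Levi-Civita connection is metric. -/
theorem fderiv_eq (h : IsMetricOn G U) {x : E} (hx : x ∈ U) (a v w : E) :
    fderiv ℝ G x a v w = G x (christoffel G x a v) w + G x v (christoffel G x a w) := by
  rw [h.symm x hx v, h.apply_christoffel hx, h.apply_christoffel hx, h.fderiv_symm hx a w v]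
  ring

theorem contDiffOn_christoffelCLM (h : IsMetricOn G U) : ContDiffOn ℝ ∞ (christoffelCLM G) U := by
  have h1 := contDiffOn_fderiv_of_isOpen h.isOpen h.smooth
  have h2 : ContDiffOn ℝ ∞ (fun y => (fderiv ℝ G y).flip) U :=
    (ContinuousLinearMap.flipₗᵢ ℝ E E (E →L[ℝ] ℝ)).toContinuousLinearEquiv.contDiff.comp_contDiffOn
      h1
  have h3 : ContDiffOn ℝ ∞ (fun y => (G y).inverse) U := fun y hy =>
    ((h.isInvertible hy).contDiffAt_map_inverse.comp y
      (h.smooth.contDiffAt (h.isOpen.mem_nhds hy))).contDiffWithinAt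
  have h4 : ContDiffOn ℝ ∞ (fun y => ContinuousLinearMap.compL ℝ E (E →L[ℝ] ℝ) E (G y).inverse) U :=
    (ContinuousLinearMap.compL ℝ E (E →L[ℝ] ℝ) E).contDiff.comp_contDiffOn h3
  exact (contDiffOn_const (c := (1 / 2 : ℝ))).smul (h4.clm_comp ((h1.add h2).sub (contDiffOn_const.clm_comp h2)))

theorem differentiableAt_christoffelCLM (h : IsMetricOn G U) {x : E} (hx : x ∈ U) :
    DifferentiableAt ℝ (christoffelCLM G) x :=
  differentiableAt_of_contDiffOn h.isOpen h.contDiffOn_christoffelCLM hx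

theorem fderiv_christoffel (h : IsMetricOn G U) {x : E} (hx : x ∈ U) (a u v : E) :
    fderiv ℝ (fun x => christoffel G x u v) x a = fderiv ℝ (christoffelCLM G) x a u v := by
  have hd := h.differentiableAt_christoffelCLM hx
  simp only [← christoffelCLM_apply]
  exact fderiv_apply_const₂ hd a u v

theorem curvature_eq (h : IsMetricOn G U) {x : E} (hx : x ∈ U) (u v w : E) :
    curvature G x u v w = fderiv ℝ (christoffelCLM G) x u v w - fderiv ℝ (christoffelCLM G) x v u w
      + christoffelCLM G x u (christoffelCLM G x v w)
      - christoffelCLM G x v (christoffelCLM G x u w) := by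
  rw [curvature, h.fderiv_christoffel hx, h.fderiv_christoffel hx]
  simp only [christoffelCLM_apply]

theorem curvature_self (h : IsMetricOn G U) {x : E} (hx : x ∈ U) (u w : E) :
    curvature G x u u w = 0 := by
  rw [h.curvature_eq hx]
  simp

/-- The metric property `fderiv_eq`, differentiated once more. The last two terms together are
symmetric in `a` and `b`, so antisymmetrizing leaves only curvature; this is how `curvature_skew`
follows. -/
theorem fderiv_fderiv_apply (h : IsMetricOn G U) {x : E} (hx : x ∈ U) (a b v w : E) :
    fderiv ℝ (fderiv ℝ G) x a b v w =
      G x (fderiv ℝ (christoffelCLM G) x a b v + christoffelCLM G x a (christoffelCLM G x b v)) w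
      + G x v (fderiv ℝ (christoffelCLM G) x a b w + christoffelCLM G x a (christoffelCLM G x b w))
      + G x (christoffelCLM G x b v) (christoffelCLM G x a w)
      + G x (christoffelCLM G x a v) (christoffelCLM G x b w) := by
  have hd := h.differentiableAt hx
  have hd1 : DifferentiableAt ℝ (fderiv ℝ G) x :=
    differentiableAt_of_contDiffOn h.isOpen (contDiffOn_fderiv_of_isOpen h.isOpen h.smooth) hx
  have hc := h.differentiableAt_christoffelCLM hx
  have h1 : Set.EqOn (fun y => fderiv ℝ G y b v w)
      (fun y => G y (christoffelCLM G y b v) w + G y v (christoffelCLM G y b w)) U := by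
    intro y hy
    simp only [christoffelCLM_apply]
    exact h.fderiv_eq hy b v w
  have h2 := congrArg (fun l => l a) (fderiv_eq_of_eqOn h.isOpen h1 hx)
  rw [fderiv_apply_const₂ (B := fun y => fderiv ℝ G y b) (by fun_prop), fderiv_apply_const hd1,
    fderiv_fun_add (by fun_prop) (by fun_prop), add_apply,
    fderiv_apply₂ (z := fun _ => w) hd (by fun_prop) (by fun_prop),
    fderiv_apply₂ (y := fun _ => v) hd (by fun_prop) (by fun_prop),
    fderiv_apply_const₂ hc, fderiv_apply_const₂ hc, h.fderiv_eq hx, h.fderiv_eq hx] at h2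
  rw [h2]
  simp only [map_add, add_apply, christoffelCLM_apply]
  simp
  ring

/-- The curvature operators are skew-symmetric. -/
theorem curvature_skew (h : IsMetricOn G U) {x : E} (hx : x ∈ U) (a b v w : E) :
    G x (curvature G x a b v) w + G x v (curvature G x a b w) = 0 := by
  have h1 := fderiv_comm h.isOpen h.smooth hx a b
  have h2 := congrArg (fun l : E →L[ℝ] E →L[ℝ] ℝ => l v w) h1
  simp only [h.fderiv_fderiv_apply hx] at h2
  rw [h.curvature_eq hx, h.curvature_eq hx]
  simp only [map_add, map_sub, add_apply, sub_apply] at h2 ⊢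
  linarith

end IsMetricOn

/-! ### Pullback of metrics -/

/-- The pullback of the metric `G` by `φ`. -/
def pullbackMetric (φ : E → E) (G : E → E →L[ℝ] E →L[ℝ] ℝ) (x : E) : E →L[ℝ] E →L[ℝ] ℝ :=
  (G (φ x)).bilinearComp (fderiv ℝ φ x) (fderiv ℝ φ x)

theorem pullbackMetric_apply (φ : E → E) (G : E → E →L[ℝ] E →L[ℝ] ℝ) (x u v : E) :
    pullbackMetric φ G x u v = G (φ x) (fderiv ℝ φ x u) (fderiv ℝ φ x v) := rfl

variable [FiniteDimensional ℝ E]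

theorem IsMetricOn.pullback (h : IsMetricOn G U) {φ : E → E} {V : Set E} (hV : IsOpen V)
    (hφ : ContDiffOn ℝ ∞ φ V) (hVU : Set.MapsTo φ V U)
    (hinj : ∀ x ∈ V, Function.Injective (fderiv ℝ φ x)) :
    IsMetricOn (pullbackMetric φ G) V where
  isOpen := hV
  smooth := by
    have h1 := contDiffOn_fderiv_of_isOpen hV hφ
    have h2 : ContDiffOn ℝ ∞ (fun x => G (φ x)) V := h.smooth.comp hφ hVU
    refine contDiffOn_clm_apply.2 fun u => contDiffOn_clm_apply.2 fun v => ?_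
    exact (h2.clm_apply (h1.clm_apply contDiffOn_const)).clm_apply (h1.clm_apply contDiffOn_const)
  symm x hx u v := h.symm _ (hVU hx) _ _
  pos x hx u hu := h.pos _ (hVU hx) _ fun h0 => hu (hinj x hx (h0.trans (map_zero _).symm))

section Naturality

variable {φ : E → E} {V : Set E}

theorem IsMetricOn.fderiv_pullback (h : IsMetricOn G U) (hV : IsOpen V)
    (hφ : ContDiffOn ℝ ∞ φ V) (hVU : Set.MapsTo φ V U) {x : E} (hx : x ∈ V) (a v w : E) :
    fderiv ℝ (pullbackMetric φ G) x a v w =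
      fderiv ℝ G (φ x) (fderiv ℝ φ x a) (fderiv ℝ φ x v) (fderiv ℝ φ x w)
      + G (φ x) (fderiv ℝ (fderiv ℝ φ) x a v) (fderiv ℝ φ x w)
      + G (φ x) (fderiv ℝ φ x v) (fderiv ℝ (fderiv ℝ φ) x a w) := by
  have h1 : DifferentiableAt ℝ (fderiv ℝ φ) x :=
    differentiableAt_of_contDiffOn hV (contDiffOn_fderiv_of_isOpen hV hφ) hx
  have h0 : DifferentiableAt ℝ φ x := differentiableAt_of_contDiffOn hV hφ hx
  have hG := h.differentiableAt (hVU hx)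
  have hGφ : DifferentiableAt ℝ (fun y => G (φ y)) x := hG.comp x h0
  have h3 : DifferentiableAt ℝ (pullbackMetric φ G) x := by
    have : ContDiffOn ℝ ∞ (pullbackMetric φ G) V := by
      have h1 := contDiffOn_fderiv_of_isOpen hV hφ
      have h2 : ContDiffOn ℝ ∞ (fun x => G (φ x)) V := h.smooth.comp hφ hVU
      refine contDiffOn_clm_apply.2 fun u => contDiffOn_clm_apply.2 fun v => ?_
      exact (h2.clm_apply (h1.clm_apply contDiffOn_const)).clm_apply
        (h1.clm_apply contDiffOn_const)
    exact differentiableAt_of_contDiffOn hV this hx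
  have h5 : fderiv ℝ (fun y => G (φ y)) x a = fderiv ℝ G (φ x) (fderiv ℝ φ x a) :=
    congrArg (fun l => l a) (fderiv_comp x hG h0)
  rw [← fderiv_apply_const₂ h3]
  simp only [pullbackMetric_apply]
  rw [fderiv_apply₂ hGφ (by fun_prop) (by fun_prop), h5, fderiv_apply_const h1,
    fderiv_apply_const h1]

/-- The transformation rule of the Christoffel symbols. -/
theorem IsMetricOn.fderiv_christoffel_pullback (h : IsMetricOn G U) (hV : IsOpen V)
    (hφ : ContDiffOn ℝ ∞ φ V) (hVU : Set.MapsTo φ V U)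
    (hinj : ∀ x ∈ V, Function.Injective (fderiv ℝ φ x)) {x : E} (hx : x ∈ V) (u v : E) :
    fderiv ℝ φ x (christoffelCLM (pullbackMetric φ G) x u v) =
      christoffelCLM G (φ x) (fderiv ℝ φ x u) (fderiv ℝ φ x v) + fderiv ℝ (fderiv ℝ φ) x u v := by
  have hP := h.pullback hV hφ hVU hinj
  have hsurj : Function.Surjective (fderiv ℝ φ x) :=
    LinearMap.surjective_of_injective (f := (fderiv ℝ φ x : E →ₗ[ℝ] E)) (hinj x hx)
  obtain ⟨z, hz⟩ := hsurj (christoffelCLM G (φ x) (fderiv ℝ φ x u) (fderiv ℝ φ x v) +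
    fderiv ℝ (fderiv ℝ φ) x u v)
  rw [christoffelCLM_apply, hP.christoffel_eq hx (z := z), hz]
  intro w
  rw [pullbackMetric_apply, hz, christoffelCLM_apply, map_add, add_apply,
    h.apply_christoffel (hVU hx), h.fderiv_pullback hV hφ hVU hx, h.fderiv_pullback hV hφ hVU hx,
    h.fderiv_pullback hV hφ hVU hx, fderiv_comm hV hφ hx v u, fderiv_comm hV hφ hx w u,
    fderiv_comm hV hφ hx w v, h.symm _ (hVU hx) (fderiv ℝ φ x v),
    h.symm _ (hVU hx) (fderiv ℝ φ x u)]
  ring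

/-- The curvature is natural under pullback. -/
theorem IsMetricOn.fderiv_curvature_pullback (h : IsMetricOn G U) (hV : IsOpen V)
    (hφ : ContDiffOn ℝ ∞ φ V) (hVU : Set.MapsTo φ V U)
    (hinj : ∀ x ∈ V, Function.Injective (fderiv ℝ φ x)) {x : E} (hx : x ∈ V) (u v w : E) :
    fderiv ℝ φ x (curvature (pullbackMetric φ G) x u v w) =
      curvature G (φ x) (fderiv ℝ φ x u) (fderiv ℝ φ x v) (fderiv ℝ φ x w) := by
  have hP := h.pullback hV hφ hVU hinj
  have c1 := contDiffOn_fderiv_of_isOpen hV hφ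
  have c2 := contDiffOn_fderiv_of_isOpen hV c1
  have h0 : DifferentiableAt ℝ φ x := differentiableAt_of_contDiffOn hV hφ hx
  have h1 : DifferentiableAt ℝ (fderiv ℝ φ) x := differentiableAt_of_contDiffOn hV c1 hx
  have h2 : DifferentiableAt ℝ (fderiv ℝ (fderiv ℝ φ)) x := differentiableAt_of_contDiffOn hV c2 hx
  have hΓ := h.differentiableAt_christoffelCLM (hVU hx)
  have hΓφ : DifferentiableAt ℝ (fun y => christoffelCLM G (φ y)) x := hΓ.comp x h0
  have hΓ' := hP.differentiableAt_christoffelCLM hx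
  have key : ∀ a b c, fderiv ℝ (fderiv ℝ φ) x a (christoffelCLM (pullbackMetric φ G) x b c) +
      fderiv ℝ φ x (fderiv ℝ (christoffelCLM (pullbackMetric φ G)) x a b c) =
      fderiv ℝ (christoffelCLM G) (φ x) (fderiv ℝ φ x a) (fderiv ℝ φ x b) (fderiv ℝ φ x c)
      + christoffelCLM G (φ x) (fderiv ℝ (fderiv ℝ φ) x a b) (fderiv ℝ φ x c)
      + christoffelCLM G (φ x) (fderiv ℝ φ x b) (fderiv ℝ (fderiv ℝ φ) x a c)
      + fderiv ℝ (fderiv ℝ (fderiv ℝ φ)) x a b c := by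
    intro a b c
    have e1 : Set.EqOn (fun y => fderiv ℝ φ y (christoffelCLM (pullbackMetric φ G) y b c))
        (fun y => christoffelCLM G (φ y) (fderiv ℝ φ y b) (fderiv ℝ φ y c)
          + fderiv ℝ (fderiv ℝ φ) y b c) V := fun y hy =>
      h.fderiv_christoffel_pullback hV hφ hVU hinj hy b c
    have e2 := congrArg (fun l => l a) (fderiv_eq_of_eqOn hV e1 hx)
    have h5 : fderiv ℝ (fun y => christoffelCLM G (φ y)) x a =
        fderiv ℝ (christoffelCLM G) (φ x) (fderiv ℝ φ x a) :=
      congrArg (fun l => l a) (fderiv_comp x hΓ h0)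
    rw [fderiv_clm_apply h1 (by fun_prop), fderiv_fun_add (by fun_prop) (by fun_prop),
      add_apply, add_apply, fderiv_apply₂ hΓφ (by fun_prop) (by fun_prop), h5,
      fderiv_apply_const h1, fderiv_apply_const h1, fderiv_apply_const₂ h2,
      ContinuousLinearMap.comp_apply, ContinuousLinearMap.flip_apply,
      fderiv_apply_const₂ hΓ'] at e2
    rw [add_comm, e2]
  have k1 := key u v w
  have k2 := key v u w
  have s3 : fderiv ℝ (fderiv ℝ (fderiv ℝ φ)) x u v w = fderiv ℝ (fderiv ℝ (fderiv ℝ φ)) x v u w :=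
    congrArg (fun l : E →L[ℝ] E => l w) (fderiv_comm hV c1 hx u v)
  have s2 := fderiv_comm hV hφ hx u v
  have r1 := h.fderiv_christoffel_pullback hV hφ hVU hinj hx u
    (christoffelCLM (pullbackMetric φ G) x v w)
  have r2 := h.fderiv_christoffel_pullback hV hφ hVU hinj hx v
    (christoffelCLM (pullbackMetric φ G) x u w)
  rw [h.fderiv_christoffel_pullback hV hφ hVU hinj hx v w] at r1
  rw [h.fderiv_christoffel_pullback hV hφ hVU hinj hx u w] at r2
  rw [hP.curvature_eq hx, h.curvature_eq (hVU hx)]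
  simp only [map_add, map_sub] at r1 r2 ⊢
  rw [r1, r2]
  -- On antisymmetrizing in `u` and `v`, the second and third derivatives of `φ` cancel by symmetry.
  rw [s3, s2] at k1
  have k : ∀ p q r s t z : E, p + q = r → s + t = z → q - t = (r - p) - (z - s) := by
    rintro p q _ s t _ rfl rfl
    abel
  rw [k _ _ _ _ _ _ k1 k2]
  abel

end Naturality

end Riemann

/-! ### Kähler metrics in a chart: the curvature as `∂̄Γ`. -/

section Kahler

open Complex

/-- The real trace of a complex linear map is twice the real part of its complex trace. -/
theorem trace_restrictScalars_complex {V : Type*} [AddCommGroup V] [Module ℂ V]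
    {ι : Type*} [Fintype ι] (b : Module.Basis ι ℂ V) (L : V →ₗ[ℂ] V) :
    LinearMap.trace ℝ V (L.restrictScalars ℝ) = 2 * (∑ i, b.repr (L (b i)) i).re := by
  classical
  rw [LinearMap.trace_eq_matrix_trace ℝ (basisOneI.smulTower b)]
  simp only [Matrix.trace, Matrix.diag, LinearMap.toMatrix_apply, LinearMap.restrictScalars_apply,
    Module.Basis.smulTower_repr, Fintype.sum_prod_type, Fin.sum_univ_two,
    Module.Basis.smulTower_apply, coe_basisOneI, coe_basisOneI_repr, map_smul,
    Finsupp.smul_apply, re_sum]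
  simp [← two_mul, Finset.mul_sum]

variable {E : Type*} [NormedAddCommGroup E] [NormedSpace ℂ E]

/-- `G` is a Kähler metric on the open set `U`: it is Hermitian, and multiplication by `i` is
parallel. -/
structure IsKahlerOn (G : E → E →L[ℝ] E →L[ℝ] ℝ) (U : Set E) : Prop extends IsMetricOn G U where
  hermitian : ∀ x ∈ U, ∀ u v : E, G x (I • u) (I • v) = G x u v
  christoffel_I : ∀ x ∈ U, ∀ u v : E,
    christoffelCLM G x u (I • v) = I • christoffelCLM G x u v

variable {G : E → E →L[ℝ] E →L[ℝ] ℝ} {U : Set E}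

/-- The endomorphism `u ↦ R(u, v) w`, whose trace is the Ricci curvature. -/
def ricciOperator (G : E → E →L[ℝ] E →L[ℝ] ℝ) (x v w : E) : E →ₗ[ℝ] E where
  toFun u := fderiv ℝ (christoffelCLM G) x u v w - fderiv ℝ (christoffelCLM G) x v u w
      + christoffelCLM G x u (christoffelCLM G x v w)
      - christoffelCLM G x v (christoffelCLM G x u w)
  map_add' a b := by
    simp only [map_add, add_apply]
    abel
  map_smul' a b := by
    simp only [map_smul, smul_apply, RingHom.id_apply]
    module

theorem IsMetricOn.ricciOperator_apply [FiniteDimensional ℝ E] (h : IsMetricOn G U) {x : E}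
    (hx : x ∈ U) (u v w : E) : ricciOperator G x v w u = curvature G x u v w :=
  (h.curvature_eq hx u v w).symm

theorem IsMetricOn.ricci_eq_trace [FiniteDimensional ℝ E] (h : IsMetricOn G U) {x : E}
    (hx : x ∈ U) (v w : E) : ricci G x v w = LinearMap.trace ℝ E (ricciOperator G x v w) := by
  classical
  rw [LinearMap.trace_eq_matrix_trace ℝ (Module.finBasis ℝ E)]
  simp [Matrix.trace, LinearMap.toMatrix_apply, ricci, Module.Basis.coord_apply,
    h.ricciOperator_apply hx]

/-- A Hermitian metric whose Kähler form is closed is Kähler. -/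
theorem IsMetricOn.isKahlerOn [FiniteDimensional ℝ E] (h : IsMetricOn G U)
    (herm : ∀ x ∈ U, ∀ u v : E, G x (I • u) (I • v) = G x u v)
    (closed : ∀ x ∈ U, ∀ u v w : E, fderiv ℝ G x u (I • v) w - fderiv ℝ G x v (I • u) w
      + fderiv ℝ G x w (I • u) v = 0) : IsKahlerOn G U := by
  refine ⟨h, herm, fun x hx u v => ?_⟩
  have hd := h.differentiableAt hx
  have hD : ∀ a b c : E, fderiv ℝ G x a (I • b) (I • c) = fderiv ℝ G x a b c := by
    intro a b c
    rw [← fderiv_apply_const₂ hd, ← fderiv_apply_const₂ hd]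
    exact congrArg (fun l => l a)
      (fderiv_eq_of_eqOn h.isOpen (fun y hy => herm y hy b c) hx)
  have hI : ∀ a : E, I • I • a = -a := fun a => by rw [smul_smul, I_mul_I, neg_one_smul]
  have hD' : ∀ a b c : E, fderiv ℝ G x a (I • b) c = - fderiv ℝ G x a b (I • c) := by
    intro a b c
    rw [← hD, hI]
    simp
  have hG' : ∀ b c : E, G x (I • b) c = - G x b (I • c) := by
    intro b c
    rw [← herm x hx, hI]
    simp
  rw [christoffelCLM_apply, christoffelCLM_apply]
  refine h.christoffel_eq hx fun w => ?_
  rw [hG', h.apply_christoffel hx]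
  -- The required identity is the difference of `c2` and `c1`, once each `I` is moved across the
  -- form by Hermitian invariance.
  have c1 := closed x hx u v w
  have c2 := closed x hx u (I • v) (I • w)
  have c3 := closed x hx u v (I • w)
  have c4 := closed x hx u (I • v) w
  simp only [hI, hD, hD', map_neg, neg_apply] at c1 c2 c3 c4 ⊢
  linarith

namespace IsKahlerOn

theorem apply_I_left (h : IsKahlerOn G U) {x : E} (hx : x ∈ U) (u v : E) :
    G x (I • u) v = - G x u (I • v) := by
  rw [← h.hermitian x hx, smul_smul, I_mul_I, neg_one_smul]
  simp

theorem apply_I_self (h : IsKahlerOn G U) {x : E} (hx : x ∈ U) (u : E) :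
    G x u (I • u) = 0 := by
  have h1 := h.apply_I_left hx u u
  rw [h.symm x hx] at h1
  linarith

theorem sectional_I (h : IsKahlerOn G U) {x : E} (hx : x ∈ U) (u : E) :
    sectional G x u (I • u) = G x (curvature G x u (I • u) (I • u)) u / G x u u ^ 2 := by
  rw [sectional, h.hermitian x hx, h.apply_I_self hx]
  ring_nf

variable [FiniteDimensional ℝ E]

theorem christoffelCLM_symm (h : IsKahlerOn G U) {x : E} (hx : x ∈ U) (u v : E) :
    christoffelCLM G x u v = christoffelCLM G x v u := by
  rw [christoffelCLM_apply, christoffelCLM_apply, h.christoffel_symm hx]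

theorem christoffel_I_left (h : IsKahlerOn G U) {x : E} (hx : x ∈ U) (u v : E) :
    christoffelCLM G x (I • u) v = I • christoffelCLM G x u v := by
  rw [h.christoffelCLM_symm hx, h.christoffel_I x hx, h.christoffelCLM_symm hx]

theorem fderiv_christoffel_symm (h : IsKahlerOn G U) {x : E} (hx : x ∈ U) (a u v : E) :
    fderiv ℝ (christoffelCLM G) x a u v = fderiv ℝ (christoffelCLM G) x a v u := by
  have hd := h.differentiableAt_christoffelCLM hx
  rw [← fderiv_apply_const₂ hd, ← fderiv_apply_const₂ hd]
  exact congrArg (fun l => l a)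
    (fderiv_eq_of_eqOn h.isOpen (fun y hy => h.christoffelCLM_symm hy u v) hx)

theorem fderiv_christoffel_I (h : IsKahlerOn G U) {x : E} (hx : x ∈ U) (a u v : E) :
    fderiv ℝ (christoffelCLM G) x a u (I • v) = I • fderiv ℝ (christoffelCLM G) x a u v := by
  have hd := h.differentiableAt_christoffelCLM hx
  rw [← fderiv_apply_const₂ hd, ← fderiv_apply_const₂ hd]
  have h1 := congrArg (fun l => l a)
    (fderiv_eq_of_eqOn h.isOpen (fun y hy => h.christoffel_I y hy u v) hx)
  rw [h1, fderiv_fun_const_smul (by fun_prop)]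
  rfl

theorem fderiv_christoffel_I_left (h : IsKahlerOn G U) {x : E} (hx : x ∈ U) (a u v : E) :
    fderiv ℝ (christoffelCLM G) x a (I • u) v = I • fderiv ℝ (christoffelCLM G) x a u v := by
  rw [h.fderiv_christoffel_symm hx, h.fderiv_christoffel_I hx, h.fderiv_christoffel_symm hx]

end IsKahlerOn

/-- The antiholomorphic derivative of the Christoffel symbols in the direction `b`. On a Kähler
metric it determines the curvature. -/
def dbarChristoffel (G : E → E →L[ℝ] E →L[ℝ] ℝ) (x b v w : E) : E :=
  (1 / 2 : ℂ) • (fderiv ℝ (christoffelCLM G) x b v w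
    + I • fderiv ℝ (christoffelCLM G) x (I • b) v w)

namespace IsKahlerOn

variable [FiniteDimensional ℝ E]

theorem dbarChristoffel_I_right (h : IsKahlerOn G U) {x : E} (hx : x ∈ U) (b v w : E) :
    dbarChristoffel G x b v (I • w) = I • dbarChristoffel G x b v w := by
  simp only [dbarChristoffel, h.fderiv_christoffel_I hx]
  module

/-- `Γ` is complex bilinear, so in the sum the `D_u Γ` terms and the `ΓΓ` terms cancel, because `I²
= -1`. What remains is `-(D_v + I D_{Iv}) Γ(u, w)`. -/
theorem curvature_add (h : IsKahlerOn G U) {x : E} (hx : x ∈ U) (u v w : E) :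
    curvature G x u v w + curvature G x u (I • v) (I • w) = (-2 : ℂ) • dbarChristoffel G x v u w := by
  have hI : ∀ a : E, I • I • a = -a := fun a => by rw [smul_smul, I_mul_I, neg_one_smul]
  rw [h.curvature_eq hx, h.curvature_eq hx, dbarChristoffel]
  simp only [h.fderiv_christoffel_I hx, h.fderiv_christoffel_I_left hx, h.christoffel_I x hx,
    h.christoffel_I_left hx, hI, map_neg, smul_smul]
  module

theorem curvature_I (h : IsKahlerOn G U) {x : E} (hx : x ∈ U) (u : E) :
    curvature G x u (I • u) (I • u) = (-2 : ℂ) • dbarChristoffel G x u u u := by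
  rw [← h.curvature_add hx, h.curvature_self hx, zero_add]

theorem curvature_I_right (h : IsKahlerOn G U) {x : E} (hx : x ∈ U) (u v w : E) :
    curvature G x u v (I • w) = I • curvature G x u v w := by
  rw [h.curvature_eq hx, h.curvature_eq hx]
  simp only [h.fderiv_christoffel_I hx, h.christoffel_I x hx]
  module

/-- By `curvature_add`, vanishing of `∂̄Γ` gives `R(u, Iv) = I R(u, v)`. Skew-symmetry of `R(u, Iv)`
then says that `R(u, v)` is symmetric; being skew as well, it is zero. -/
theorem curvature_eq_zero (h : IsKahlerOn G U) {x : E} (hx : x ∈ U)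
    (h0 : ∀ b v w, dbarChristoffel G x b v w = 0) (u v w : E) : curvature G x u v w = 0 := by
  have hI : ∀ a : E, I • I • a = -a := fun a => by rw [smul_smul, I_mul_I, neg_one_smul]
  have h1 : ∀ w, curvature G x u (I • v) w = I • curvature G x u v w := by
    intro w
    have h2 := h.curvature_add hx u v w
    rw [h0, smul_zero, h.curvature_I_right hx] at h2
    have h3 := congrArg (fun z => I • z) h2
    simp only [smul_add, hI, smul_zero] at h3
    rw [← sub_eq_add_neg, sub_eq_zero] at h3
    exact h3.symm
  refine h.eq_of_forall hx fun t => ?_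
  have s1 := h.curvature_skew hx u (I • v) w (I • t)
  have s2 := h.curvature_skew hx u v w t
  rw [h1, h1, h.curvature_I_right hx, hI, h.hermitian x hx] at s1
  simp only [map_neg, map_zero, zero_apply] at s1 ⊢
  linarith

/-- For a Ricci-flat Kähler metric the complex trace of the curvature vanishes. -/
theorem sum_repr_dbarChristoffel [FiniteDimensional ℂ E] (h : IsKahlerOn G U) {x : E} (hx : x ∈ U)
    (hric : ∀ v w, ricci G x v w = 0)
    {ι : Type*} [Fintype ι] (e : Module.Basis ι ℂ E) (b w : E) :
    ∑ i, e.repr (dbarChristoffel G x b (e i) w) i = 0 := by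
  have hre : ∀ w, (∑ i, e.repr (dbarChristoffel G x b (e i) w) i).re = 0 := by
    intro w
    have h1 := h.ricci_eq_trace hx b w
    have h2 := h.ricci_eq_trace hx (I • b) (I • w)
    rw [hric] at h1 h2
    -- The operators with traces `Ric(b, w)` and `Ric(Ib, Iw)` add up to a complex linear map, so
    -- twice the real part of its complex trace is a sum of Ricci curvatures.
    let L : E →ₗ[ℂ] E :=
      { toFun := fun u => (-2 : ℂ) • dbarChristoffel G x b u w
        map_add' := fun a b => by
          simp only [dbarChristoffel, map_add, add_apply]
          module
        map_smul' := fun c a => by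
          have : ∀ a : E, c • a = c.re • a + c.im • (I • a) := by
            intro a
            conv_lhs => rw [← re_add_im c]
            rw [add_smul, mul_smul]
            rfl
          rw [this]
          simp only [dbarChristoffel, map_add, map_smul, add_apply, RingHom.id_apply,
            smul_apply, h.fderiv_christoffel_I_left hx]
          rw [this]
          module }
    have h3 := trace_restrictScalars_complex e L
    have h4 : L.restrictScalars ℝ =
        ricciOperator G x b w + ricciOperator G x (I • b) (I • w) := by
      ext u
      rw [LinearMap.add_apply, h.ricciOperator_apply hx, h.ricciOperator_apply hx,
        h.curvature_add hx]
      rfl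
    rw [h4, map_add, ← h1, ← h2] at h3
    simp only [L, LinearMap.coe_mk, AddHom.coe_mk, map_smul, Finsupp.smul_apply, smul_eq_mul,
      ← Finset.mul_sum] at h3
    simp at h3
    simpa using h3
  refine Complex.ext (hre w) ?_
  -- Replacing `w` by `I • w` multiplies the trace by `I`, so the real-part statement also yields
  -- the imaginary part.
  have h1 := hre (I • w)
  simp only [h.dbarChristoffel_I_right hx, map_smul, Finsupp.smul_apply, smul_eq_mul,
    ← Finset.mul_sum] at h1
  simpa using h1

/-- The pullback of a Kähler metric by a holomorphic map. -/
theorem pullback (h : IsKahlerOn G U) {φ : E → E} {V : Set E} (hV : IsOpen V)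
    (hφ : ContDiffOn ℝ ∞ φ V) (hVU : Set.MapsTo φ V U)
    (hinj : ∀ x ∈ V, Function.Injective (fderiv ℝ φ x))
    (hhol : ∀ x ∈ V, ∀ u : E, fderiv ℝ φ x (I • u) = I • fderiv ℝ φ x u) :
    IsKahlerOn (pullbackMetric φ G) V where
  toIsMetricOn := h.toIsMetricOn.pullback hV hφ hVU hinj
  hermitian x hx u v := by
    rw [pullbackMetric_apply, hhol x hx, hhol x hx, h.hermitian _ (hVU hx), pullbackMetric_apply]
  christoffel_I x hx u v := by
    apply hinj x hx
    have h1 : DifferentiableAt ℝ (fderiv ℝ φ) x :=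
      differentiableAt_of_contDiffOn hV (contDiffOn_fderiv_of_isOpen hV hφ) hx
    have h2 : fderiv ℝ (fderiv ℝ φ) x u (I • v) = I • fderiv ℝ (fderiv ℝ φ) x u v := by
      rw [← fderiv_apply_const h1, ← fderiv_apply_const h1]
      have := congrArg (fun l => l u) (fderiv_eq_of_eqOn hV (fun y hy => hhol y hy v) hx)
      rw [this, fderiv_fun_const_smul (by fun_prop)]
      rfl
    rw [hhol x hx, h.fderiv_christoffel_pullback hV hφ hVU hinj hx,
      h.fderiv_christoffel_pullback hV hφ hVU hinj hx, hhol x hx, h.christoffel_I _ (hVU hx), h2,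
      smul_add]

end IsKahlerOn

end Kahler

/-! ### The formal Laplacian of the curvature. -/

section Algebra

/-- The formal identity behind the Laplacian of the holomorphic sectional curvature. Here `h` is the
matrix of a Kähler metric, `Γ` are its Christoffel symbols, and `ev` is the evaluation at the centre
of normal coordinates. -/
theorem laplacian_dbar_christoffel {A : Type*} [CommRing A] [Algebra ℂ A]
    (d d' : Fin 2 → Derivation ℂ A A)
    (hdd : ∀ i j x, d i (d j x) = d j (d i x)) (hdd' : ∀ i j x, d' i (d' j x) = d' j (d' i x))
    (hcomm : ∀ i j x, d i (d' j x) = d' j (d i x)) (ev : A →ₐ[ℂ] ℂ)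
    (h : Fin 2 → Fin 2 → A) (Γ Γ' : Fin 2 → Fin 2 → Fin 2 → A)
    (hs : ∀ i j l, Γ i j l = Γ j i l) (hs' : ∀ i j l, Γ' i j l = Γ' j i l)
    (hd : ∀ k i j, d k (h i j) = ∑ l, Γ k i l * h l j)
    (hd' : ∀ k i j, d' k (h i j) = ∑ l, Γ' k j l * h i l)
    (htr : ∀ k j, d' k (∑ l, Γ j l l) = 0)
    (h1 : ∀ i j, ev (h i j) = if i = j then 1 else 0)
    (hΓ : ∀ i j l, ev (Γ i j l) = 0) (hΓ' : ∀ i j l, ev (Γ' i j l) = 0) :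
    ev (∑ k, d k (d' k (∑ l, d' 0 (Γ 0 0 l) * h l 0))) =
      2 * ∑ k, ∑ l, ev (d' 0 (Γ 0 k l)) * ev (d' 0 (Γ 0 l k))
      - ∑ k, ∑ l, ev (d' k (Γ 0 0 l)) * ev (d k (Γ' 0 0 l)) := by
  have evd : ∀ k i j, ev (d k (h i j)) = 0 := by
    intro k i j
    rw [hd, map_sum]
    simp [hΓ]
  have evd' : ∀ k i j, ev (d' k (h i j)) = 0 := by
    intro k i j
    rw [hd', map_sum]
    simp [hΓ']
  have evdd : ∀ a k i j, ev (d a (d k (h i j))) = ev (d a (Γ k i j)) := by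
    intro a k i j
    rw [hd, map_sum, map_sum]
    simp [evd, hΓ, h1]
  have evd'd : ∀ a k i j, ev (d' a (d k (h i j))) = ev (d' a (Γ k i j)) := by
    intro a k i j
    rw [hd, map_sum, map_sum]
    simp [evd', hΓ, h1]
  have evd'd' : ∀ a k i j, ev (d' a (d' k (h i j))) = ev (d' a (Γ' k j i)) := by
    intro a k i j
    rw [hd', map_sum, map_sum]
    simp [evd', hΓ', h1]
  have sd : ∀ k i j, d k (h i j) = d i (h k j) := by
    intro k i j
    rw [hd, hd]
    simp only [hs k i]
  have sd' : ∀ k i j, d' k (h i j) = d' j (h i k) := by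
    intro k i j
    rw [hd', hd']
    simp only [hs' k j]
  -- The usual formula for the Kähler curvature: a mixed second derivative of `h` minus a quadratic
  -- term in first derivatives.
  have e1 : ∑ l, d' 0 (Γ 0 0 l) * h l 0 =
      d' 0 (d 0 (h 0 0)) - ∑ l, Γ 0 0 l * d' 0 (h l 0) := by
    rw [hd, map_sum, eq_sub_iff_add_eq, ← Finset.sum_add_distrib]
    refine Finset.sum_congr rfl fun l _ => ?_
    simp only [Derivation.leibniz, smul_eq_mul]
    ring
  -- The Kähler symmetries `sd` and `sd'` trade the two indices of `h 0 0` for those of the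
  -- Laplacian. The sum over `k` then meets `h k k`, where Ricci-flatness can act.
  have e2 : ∀ k, d k (d' k (d' 0 (d 0 (h 0 0)))) = d 0 (d' 0 (d' 0 (d 0 (h k k)))) := by
    intro k
    simp only [hcomm]
    rw [hdd k 0, sd k 0 0, hdd' k 0, ← hcomm 0 k, ← hcomm 0 k, sd' k k 0, hcomm, hcomm]
  have e3 : ∀ k, ev (d k (d' k (∑ l, Γ 0 0 l * d' 0 (h l 0)))) =
      ∑ l, (ev (d k (Γ 0 0 l)) * ev (d' k (Γ' 0 0 l))
        + ev (d' k (Γ 0 0 l)) * ev (d k (Γ' 0 0 l))) := by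
    intro k
    rw [map_sum, map_sum, map_sum]
    refine Finset.sum_congr rfl fun l _ => ?_
    have h5 : ev (d k (d' 0 (h l 0))) = ev (d k (Γ' 0 0 l)) := by
      rw [hd', map_sum, map_sum]
      simp [evd, hΓ', h1]
    simp only [Derivation.leibniz, smul_eq_mul, map_add, map_mul, hΓ, evd', evd'd', h5]
    ring
  have e4 : ev (∑ k, d 0 (d' 0 (d' 0 (d 0 (h k k))))) =
      2 * ∑ k, ∑ l, ev (d' 0 (Γ 0 k l)) * ev (d' 0 (Γ 0 l k))
      + ∑ k, ∑ l, ev (d 0 (Γ 0 k l)) * ev (d' 0 (Γ' 0 k l)) := by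
    have h6 : ∀ k, ev (d 0 (d' 0 (d' 0 (d 0 (h k k))))) =
        ev (d 0 (d' 0 (d' 0 (Γ 0 k k)))) + ∑ l, (2 * (ev (d' 0 (Γ 0 k l)) * ev (d' 0 (Γ 0 l k)))
          + ev (d 0 (Γ 0 k l)) * ev (d' 0 (Γ' 0 k l))) := by
      intro k
      rw [hd]
      simp only [map_sum]
      have h7 : ∀ l, ev (d 0 (d' 0 (d' 0 (Γ 0 k l * h l k)))) =
          ev (d 0 (d' 0 (d' 0 (Γ 0 k l)))) * ev (h l k)
          + (2 * (ev (d' 0 (Γ 0 k l)) * ev (d' 0 (Γ 0 l k)))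
          + ev (d 0 (Γ 0 k l)) * ev (d' 0 (Γ' 0 k l))) := by
        intro l
        simp only [Derivation.leibniz, smul_eq_mul, map_add, map_mul, hΓ, evd', evd, evd'd',
          hcomm 0 0 (h l k), evd'd]
        ring
      simp only [h7, Finset.sum_add_distrib, h1]
      simp
    -- The trace of `Γ` is the logarithmic derivative of `det h`, and its `∂̄` is the Ricci form;
    -- `htr` says that this is zero.
    have h8 : ∑ k, ev (d 0 (d' 0 (d' 0 (Γ 0 k k)))) = 0 := by
      rw [← map_sum, ← map_sum, ← map_sum, ← map_sum, htr]
      simp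
    rw [map_sum]
    simp only [h6, Finset.sum_add_distrib, h8, Finset.mul_sum, zero_add]
  -- The products of a pure `∂Γ` with a pure `∂̄Γ'` in `e3` and `e4` agree and cancel. Hence it is
  -- enough that `Γ` itself vanishes at the centre; no higher-order normalization is needed.
  have e5 : ∀ k l, ev (d k (Γ 0 0 l)) = ev (d 0 (Γ 0 k l)) := by
    intro k l
    rw [← evdd, hdd, sd k 0, evdd]
  have e6 : ∀ k l, ev (d' k (Γ' 0 0 l)) = ev (d' 0 (Γ' 0 k l)) := by
    intro k l
    rw [← evd'd', hdd', sd' k, evd'd', hs']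
  have e7 : ∀ k, d k (d' k (∑ l, d' 0 (Γ 0 0 l) * h l 0)) =
      d 0 (d' 0 (d' 0 (d 0 (h k k)))) - d k (d' k (∑ l, Γ 0 0 l * d' 0 (h l 0))) := by
    intro k
    rw [e1, map_sub, map_sub, e2]
  simp only [e7, Finset.sum_sub_distrib]
  rw [map_sub, e4, map_sum]
  simp only [e3, e5, e6, Finset.sum_add_distrib]
  ring

end Algebra

/-! ### Smooth functions as an algebra with derivations; second derivatives at a minimum. -/

section SmoothFunctions

open TopologicalSpace Complex

/-- The second derivative of a function of one variable is nonnegative at a local minimum. -/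
theorem IsLocalMin.deriv_deriv_nonneg {g : ℝ → ℝ} {t : ℝ} (hg : IsLocalMin g t)
    (hc : ContinuousAt g t) : 0 ≤ deriv (deriv g) t := by
  by_contra! hneg
  -- A negative second derivative would make `t` a local maximum too, so `g` would be locally
  -- constant and its second derivative zero.
  have hmax := isLocalMax_of_deriv_deriv_neg hneg hg.deriv_eq_zero hc
  have hconst : g =ᶠ[𝓝 t] fun _ => g t := by
    filter_upwards [hg, hmax] with s h1 h2 using le_antisymm h2 h1
  have h1 : deriv g =ᶠ[𝓝 t] fun _ => 0 := by
    have := hconst.deriv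
    simpa using this
  have h2 := h1.deriv_eq
  rw [h2] at hneg
  simp at hneg

theorem IsLocalMin.fderiv_fderiv_nonneg {E : Type*} [NormedAddCommGroup E] [NormedSpace ℝ E]
    {f : E → ℝ} {U : Set E} (hU : IsOpen U) (hf : ContDiffOn ℝ ∞ f U) {x : E} (hx : x ∈ U)
    (hmin : IsLocalMin f x) (v : E) : 0 ≤ fderiv ℝ (fun y => fderiv ℝ f y v) x v := by
  have hline : ∀ t : ℝ, HasDerivAt (fun t : ℝ => x + t • v) v t := by
    intro t
    simpa using ((hasDerivAt_id t).smul_const v).const_add x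
  have hlc : Continuous (fun t : ℝ => x + t • v) := by fun_prop
  have hx0 : x + (0 : ℝ) • v = x := by simp
  have hmem : ∀ᶠ t : ℝ in 𝓝 0, x + t • v ∈ U :=
    hlc.continuousAt.eventually (by simpa using hU.mem_nhds hx)
  have hd1 : deriv (fun t : ℝ => f (x + t • v)) =ᶠ[𝓝 0] fun t => fderiv ℝ f (x + t • v) v := by
    filter_upwards [hmem] with t ht
    exact ((differentiableAt_of_contDiffOn hU hf ht).hasFDerivAt.comp_hasDerivAt t (hline t)).deriv
  have hf1 : ContDiffOn ℝ ∞ (fun y => fderiv ℝ f y v) U :=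
    (contDiffOn_fderiv_of_isOpen hU hf).clm_apply contDiffOn_const
  have hd2 : deriv (fun t : ℝ => fderiv ℝ f (x + t • v) v) 0 =
      fderiv ℝ (fun y => fderiv ℝ f y v) x v := by
    have h1 := (differentiableAt_of_contDiffOn hU hf1 (by rwa [hx0] :
      x + (0 : ℝ) • v ∈ U)).hasFDerivAt.comp_hasDerivAt 0 (hline 0)
    have h2 := h1.deriv
    rw [hx0] at h2
    exact h2
  have hmin' : IsLocalMin (fun t : ℝ => f (x + t • v)) 0 := by
    have : ∀ᶠ y in 𝓝 (x + (0 : ℝ) • v), f x ≤ f y := by rw [hx0]; exact hmin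
    have h3 := hlc.continuousAt.eventually this
    filter_upwards [h3] with t ht
    simpa using ht
  have hc : ContinuousAt (fun t : ℝ => f (x + t • v)) 0 := by
    refine ContinuousAt.comp (g := f) ?_ hlc.continuousAt
    rw [hx0]
    exact (differentiableAt_of_contDiffOn hU hf hx).continuousAt
  have h := hmin'.deriv_deriv_nonneg hc
  rwa [hd1.deriv_eq, hd2] at h

variable {E : Type*} [NormedAddCommGroup E] {U : Opens E}

/-- Extension by zero of a function on an open set. -/
def extendZero (f : U → ℂ) : E → ℂ := Function.extend Subtype.val f 0

theorem extendZero_apply (f : U → ℂ) (x : U) : extendZero f x = f x :=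
  Subtype.val_injective.extend_apply f 0 x

variable [NormedSpace ℝ E]

theorem contDiffOn_extendZero_iff {f : U → ℂ} {g : E → ℂ} (hfg : ∀ x : U, f x = g x) :
    ContDiffOn ℝ ∞ (extendZero f) U ↔ ContDiffOn ℝ ∞ g U :=
  contDiffOn_congr fun x hx => (extendZero_apply f ⟨x, hx⟩).trans (hfg ⟨x, hx⟩)

variable (U) in
/-- The algebra of smooth complex functions on an open set. -/
def smoothAlgebra : Subalgebra ℂ (U → ℂ) where
  carrier := {f | ContDiffOn ℝ ∞ (extendZero f) U}
  mul_mem' {a b} ha hb := (contDiffOn_extendZero_iff (g := fun x => extendZero a x * extendZero b x)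
    fun x => by simp [extendZero_apply]).2 (ContDiffOn.mul ha hb)
  add_mem' {a b} ha hb := (contDiffOn_extendZero_iff (g := fun x => extendZero a x + extendZero b x)
    fun x => by simp [extendZero_apply]).2 (ContDiffOn.add ha hb)
  algebraMap_mem' r := (contDiffOn_extendZero_iff (g := fun _ => r) fun _ => rfl).2 contDiffOn_const

/-- A smooth function on an open set, as an element of the algebra of smooth functions. -/
def toSmooth (f : E → ℂ) (hf : ContDiffOn ℝ ∞ f U) : smoothAlgebra U :=
  ⟨fun x => f x, (contDiffOn_extendZero_iff fun _ => rfl).2 hf⟩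

theorem differentiableAt_extendZero (f : smoothAlgebra U) (x : U) :
    DifferentiableAt ℝ (extendZero f.1) x :=
  differentiableAt_of_contDiffOn U.isOpen f.2 x.2

theorem fderiv_extendZero {f : smoothAlgebra U} {g : E → ℂ} (hfg : ∀ x : U, f.1 x = g x) (x : U) :
    fderiv ℝ (extendZero f.1) x = fderiv ℝ g x :=
  fderiv_eq_of_eqOn U.isOpen
    (fun y hy => (extendZero_apply f.1 ⟨y, hy⟩).trans (hfg ⟨y, hy⟩)) x.2

/-- The directional derivative, as a derivation of the algebra of smooth functions. -/
def dirDeriv (v : E) : Derivation ℂ (smoothAlgebra U) (smoothAlgebra U) :=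
  Derivation.mk'
    { toFun := fun f => toSmooth (fun x => fderiv ℝ (extendZero f.1) x v)
        ((contDiffOn_fderiv_of_isOpen U.isOpen f.2).clm_apply contDiffOn_const)
      map_add' := fun f g => by
        ext x
        change fderiv ℝ (extendZero (f + g).1) x v = _
        rw [fderiv_extendZero (f := f + g) (g := fun x => extendZero f.1 x + extendZero g.1 x)
          (fun x => by simp [extendZero_apply]), fderiv_fun_add (differentiableAt_extendZero f x)
          (differentiableAt_extendZero g x)]
        rfl
      map_smul' := fun c f => by
        ext x
        change fderiv ℝ (extendZero (c • f).1) x v = _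
        rw [fderiv_extendZero (f := c • f) (g := fun x => c • extendZero f.1 x)
          (fun x => by simp [extendZero_apply]),
          fderiv_fun_const_smul (differentiableAt_extendZero f x)]
        rfl }
    fun f g => by
      ext x
      change fderiv ℝ (extendZero (f * g).1) x v =
        f.1 x * fderiv ℝ (extendZero g.1) x v + g.1 x * fderiv ℝ (extendZero f.1) x v
      rw [fderiv_extendZero (f := f * g) (g := fun x => extendZero f.1 x * extendZero g.1 x)
          (fun x => by simp [extendZero_apply]), fderiv_fun_mul (differentiableAt_extendZero f x)
          (differentiableAt_extendZero g x)]
      simp [extendZero_apply]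

theorem dirDeriv_apply (v : E) {f : smoothAlgebra U} {g : E → ℂ} (hfg : ∀ x : U, f.1 x = g x)
    (x : U) : (dirDeriv v f).1 x = fderiv ℝ g x v := by
  rw [← fderiv_extendZero hfg]
  rfl

theorem dirDeriv_comm (v w : E) (f : smoothAlgebra U) :
    dirDeriv v (dirDeriv w f) = dirDeriv w (dirDeriv v f) := by
  ext x
  have hd : DifferentiableAt ℝ (fderiv ℝ (extendZero f.1)) x :=
    differentiableAt_of_contDiffOn U.isOpen (contDiffOn_fderiv_of_isOpen U.isOpen f.2) x.2
  rw [dirDeriv_apply v (g := fun x => fderiv ℝ (extendZero f.1) x w) (fun _ => rfl),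
    dirDeriv_apply w (g := fun x => fderiv ℝ (extendZero f.1) x v) (fun _ => rfl),
    fderiv_apply_const hd, fderiv_apply_const hd, fderiv_comm U.isOpen f.2 x.2]

/-- Evaluation of smooth functions at a point. -/
def evalAt (x : U) : smoothAlgebra U →ₐ[ℂ] ℂ :=
  (Pi.evalAlgHom ℂ (fun _ : U => ℂ) x).comp (smoothAlgebra U).val

theorem evalAt_apply (x : U) (f : smoothAlgebra U) : evalAt x f = f.1 x := rfl

theorem re_dirDeriv_dirDeriv_nonneg {f : smoothAlgebra U} {x : U} (hx : (f.1 x).re = 0)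
    (hf : ∀ y, 0 ≤ (f.1 y).re) (v : E) : 0 ≤ ((dirDeriv v (dirDeriv v f)).1 x).re := by
  have hr : ContDiffOn ℝ ∞ (fun y => (extendZero f.1 y).re) U :=
    reCLM.contDiff.comp_contDiffOn f.2
  have hmin : IsLocalMin (fun y => (extendZero f.1 y).re) x := by
    filter_upwards [U.isOpen.mem_nhds x.2] with y hy
    rw [extendZero_apply, hx]
    exact (hf ⟨y, hy⟩).trans_eq (congrArg re (extendZero_apply f.1 ⟨y, hy⟩).symm)
  have hre : ∀ (g : smoothAlgebra U) (y : U) (w : E),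
      fderiv ℝ (fun y => (extendZero g.1 y).re) y w = (fderiv ℝ (extendZero g.1) y w).re := by
    intro g y w
    have := (reCLM.hasFDerivAt.comp (y : E) (differentiableAt_extendZero g y).hasFDerivAt).fderiv
    exact congrArg (fun l => l w) this
  have h := hmin.fderiv_fderiv_nonneg U.isOpen hr x.2 v
  have he : Set.EqOn (fun y => fderiv ℝ (fun y => (extendZero f.1 y).re) y v)
      (fun y => (extendZero (dirDeriv v f).1 y).re) U := by
    intro y hy
    simp only [hre f ⟨y, hy⟩ v, extendZero_apply (dirDeriv v f).1 ⟨y, hy⟩]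
    rfl
  rw [fderiv_eq_of_eqOn U.isOpen he x.2, hre] at h
  exact h

end SmoothFunctions

/-! ### Wirtinger derivatives. -/

section Wirtinger

open TopologicalSpace Complex

variable {E : Type*} [NormedAddCommGroup E] [NormedSpace ℂ E] {U : Opens E}

/-- The complex derivation `½ (D_v + ε D_{iv})`: the holomorphic derivative for `ε = -i` and the
antiholomorphic one for `ε = i`. -/
def wirtinger (ε : ℂ) (v : E) : Derivation ℂ (smoothAlgebra U) (smoothAlgebra U) :=
  (1 / 2 : ℂ) • ((dirDeriv v : Derivation ℂ (smoothAlgebra U) (smoothAlgebra U)) +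
    ε • (dirDeriv (I • v) : Derivation ℂ (smoothAlgebra U) (smoothAlgebra U)))

theorem wirtinger_def (ε : ℂ) (v : E) (f : smoothAlgebra U) :
    wirtinger ε v f = (1 / 2 : ℂ) • (dirDeriv v f + ε • dirDeriv (I • v) f) := rfl

theorem wirtinger_apply (ε : ℂ) (v : E) {f : smoothAlgebra U} {g : E → ℂ}
    (hfg : ∀ x : U, f.1 x = g x) (x : U) :
    (wirtinger ε v f).1 x = 1 / 2 * (fderiv ℝ g x v + ε * fderiv ℝ g x (I • v)) := by
  rw [← dirDeriv_apply v hfg, ← dirDeriv_apply (I • v) hfg]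
  rfl

theorem wirtinger_comm (ε ε' : ℂ) (v w : E) (f : smoothAlgebra U) :
    wirtinger ε v (wirtinger ε' w f) = wirtinger ε' w (wirtinger ε v f) := by
  simp only [wirtinger_def, Derivation.map_smul, map_add, dirDeriv_comm v, dirDeriv_comm (I • v)]
  module

/-- Since `D_v` and `D_{iv}` commute, `∂_v ∂̄_v = ¼ (D_v² + D_{iv}²)`, and both second derivatives
are nonnegative at a minimum of the real part. -/
theorem re_wirtinger_wirtinger_nonneg {f : smoothAlgebra U} {x : U} (hx : (f.1 x).re = 0)
    (hf : ∀ y, 0 ≤ (f.1 y).re) (v : E) :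
    0 ≤ (evalAt x (wirtinger (-I) v (wirtinger I v f))).re := by
  have h : wirtinger (-I) v (wirtinger I v f) =
      (1 / 4 : ℂ) • (dirDeriv v (dirDeriv v f) + dirDeriv (I • v) (dirDeriv (I • v) f)) := by
    simp only [wirtinger_def, Derivation.map_smul, map_add, dirDeriv_comm (I • v) v]
    have hI : I * I = -1 := I_mul_I
    match_scalars
    · ring
    · ring
    · linear_combination (-1 / 4 : ℂ) * hI
  have h1 := re_dirDeriv_dirDeriv_nonneg hx hf v
  have h2 := re_dirDeriv_dirDeriv_nonneg hx hf (I • v)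
  rw [h, map_smul, map_add, evalAt_apply, evalAt_apply]
  have : (1 / 4 : ℂ) = ((1 / 4 : ℝ) : ℂ) := by norm_num
  rw [this, smul_eq_mul, re_ofReal_mul, add_re]
  positivity

theorem wirtinger_conj (ε : ℂ) (v : E) {f g : smoothAlgebra U}
    (hfg : ∀ x, g.1 x = starRingEnd ℂ (f.1 x)) (x : U) :
    evalAt x (wirtinger ε v g) = starRingEnd ℂ (evalAt x (wirtinger (starRingEnd ℂ ε) v f)) := by
  have h1 : ∀ w, fderiv ℝ (fun y => starRingEnd ℂ (extendZero f.1 y)) x w =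
      starRingEnd ℂ (fderiv ℝ (extendZero f.1) x w) := by
    intro w
    have := ((conjCLE : ℂ →L[ℝ] ℂ).hasFDerivAt.comp (x : E)
      (differentiableAt_extendZero f x).hasFDerivAt).fderiv
    exact congrArg (fun l => l w) this
  rw [evalAt_apply, evalAt_apply,
    wirtinger_apply ε v (g := fun y => starRingEnd ℂ (extendZero f.1 y))
      (fun y => by rw [hfg, extendZero_apply]),
    wirtinger_apply _ v (g := extendZero f.1) (fun y => (extendZero_apply _ y).symm), h1, h1]
  simp [conj_ofNat]

end Wirtinger

/-! ### Linear algebra of Ricci-flat Kähler curvature tensors in dimension two. -/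

section CurvatureAlgebra

open Complex

/-- The symmetries of the components `S b i j l` (antilinear in `b` and `l`, linear in `i` and `j`)
of the curvature of a Ricci-flat Kähler surface in a unitary frame. -/
structure IsKahlerTensor (S : Fin 2 → Fin 2 → Fin 2 → Fin 2 → ℂ) : Prop where
  symm_mid : ∀ b i j l, S b i j l = S b j i l
  symm_out : ∀ b i j l, S b i j l = S l i j b
  conj : ∀ b i j l, starRingEnd ℂ (S b i j l) = S i b l j
  trace : ∀ b i, ∑ j, S b i j j = 0

/-- The quartic form of a curvature tensor. -/
def quarticForm (S : Fin 2 → Fin 2 → Fin 2 → Fin 2 → ℂ) (z : Fin 2 → ℂ) : ℂ :=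
  ∑ b, ∑ i, ∑ j, ∑ l, S b i j l * z i * z j * starRingEnd ℂ (z b) * starRingEnd ℂ (z l)

namespace IsKahlerTensor

variable {S : Fin 2 → Fin 2 → Fin 2 → Fin 2 → ℂ}

/-- A trace-free curvature tensor has three independent components. -/
theorem exists_components (h : IsKahlerTensor S) : ∃ (a : ℝ) (β γ : ℂ),
    (S 0 0 0 0 = a ∧ S 1 1 1 1 = a) ∧
    (S 0 0 1 1 = -a ∧ S 0 1 0 1 = -a ∧ S 1 0 1 0 = -a ∧ S 1 1 0 0 = -a) ∧
    (S 0 0 0 1 = β ∧ S 1 0 0 0 = β ∧ S 1 0 1 1 = -β ∧ S 1 1 0 1 = -β) ∧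
    (S 0 0 1 0 = starRingEnd ℂ β ∧ S 0 1 0 0 = starRingEnd ℂ β ∧
      S 0 1 1 1 = -starRingEnd ℂ β ∧ S 1 1 1 0 = -starRingEnd ℂ β) ∧
    (S 1 0 0 1 = γ ∧ S 0 1 1 0 = starRingEnd ℂ γ) := by
  have t := h.trace
  simp only [Fin.sum_univ_two] at t
  have hre : S 0 0 0 0 = ((S 0 0 0 0).re : ℂ) := (conj_eq_iff_re.1 (h.conj 0 0 0 0)).symm
  have t00 := t 0 0
  have t11 := t 1 1
  have t10 := t 1 0
  have e1 : S 0 1 0 1 = S 0 0 1 1 := h.symm_mid 0 1 0 1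
  have e2 : S 1 0 1 0 = S 0 0 1 1 := h.symm_out 1 0 1 0
  have e3 : S 1 1 0 0 = S 1 0 1 0 := h.symm_mid 1 1 0 0
  have e4 : S 1 0 0 0 = S 0 0 0 1 := h.symm_out 1 0 0 0
  have e5 : S 1 1 0 1 = S 1 0 1 1 := h.symm_mid 1 1 0 1
  have e6 : starRingEnd ℂ (S 0 0 0 1) = S 0 0 1 0 := h.conj 0 0 0 1
  have e7 : S 0 1 0 0 = S 0 0 1 0 := h.symm_mid 0 1 0 0
  have e8 : starRingEnd ℂ (S 1 0 1 1) = S 0 1 1 1 := h.conj 1 0 1 1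
  have e9 : S 1 1 1 0 = S 0 1 1 1 := h.symm_out 1 1 1 0
  have e10 : starRingEnd ℂ (S 1 0 0 1) = S 0 1 1 0 := h.conj 1 0 0 1
  have d1 : S 0 0 1 1 = -((S 0 0 0 0).re : ℂ) := by
    rw [← hre]; linear_combination t00
  have d2 : S 1 0 1 1 = - S 0 0 0 1 := by linear_combination t10 - e4
  refine ⟨(S 0 0 0 0).re, S 0 0 0 1, S 1 0 0 1, ⟨hre, ?_⟩, ⟨d1, e1.trans d1, e2.trans d1,
    (e3.trans e2).trans d1⟩, ⟨rfl, e4, d2, e5.trans d2⟩,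
    ⟨e6.symm, e7.trans e6.symm, ?_, ?_⟩, rfl, e10.symm⟩
  · linear_combination t11 - e3 - e2 - d1
  · rw [← e8, d2, map_neg]
  · rw [e9, ← e8, d2, map_neg]

/-- The cubic has a maximum at `t = 0`, so its derivative there vanishes. -/
theorem linear_coeff_eq_zero {p q r : ℝ} (h : ∀ t : ℝ, p * t + q * t ^ 2 + r * t ^ 3 ≤ 0) :
    p = 0 := by
  have hd : HasDerivAt (fun t : ℝ => p * t + q * t ^ 2 + r * t ^ 3) p 0 := by
    have h1 := (((hasDerivAt_id (0 : ℝ)).const_mul p).add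
      (((hasDerivAt_id (0 : ℝ)).pow 2).const_mul q)).add
      (((hasDerivAt_id (0 : ℝ)).pow 3).const_mul r)
    convert! h1 using 1
    simp
  have hm : IsLocalMax (fun t : ℝ => p * t + q * t ^ 2 + r * t ^ 3) 0 :=
    Filter.Eventually.of_forall fun t => by simpa using h t
  exact hm.hasDerivAt_eq_zero hd

/-- On the vectors `(1, tw)` the term linear in `t` isolates `β`, and varying the phase of `w` in
the `t²` term isolates `γ`. -/
theorem re_quarticForm {a : ℝ} {β γ : ℂ}
    (h0 : S 0 0 0 0 = a ∧ S 1 1 1 1 = a)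
    (h1 : S 0 0 1 1 = -a ∧ S 0 1 0 1 = -a ∧ S 1 0 1 0 = -a ∧ S 1 1 0 0 = -a)
    (h2 : S 0 0 0 1 = β ∧ S 1 0 0 0 = β ∧ S 1 0 1 1 = -β ∧ S 1 1 0 1 = -β)
    (h3 : S 0 0 1 0 = starRingEnd ℂ β ∧ S 0 1 0 0 = starRingEnd ℂ β ∧
      S 0 1 1 1 = -starRingEnd ℂ β ∧ S 1 1 1 0 = -starRingEnd ℂ β)
    (h4 : S 1 0 0 1 = γ ∧ S 0 1 1 0 = starRingEnd ℂ γ) (t : ℝ) (w : ℂ) :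
    (quarticForm S ![1, t * w]).re = a + a * t ^ 4 * normSq w ^ 2 - 4 * a * t ^ 2 * normSq w
      + 4 * (β * starRingEnd ℂ w).re * (t - t ^ 3 * normSq w)
      + 2 * (γ * starRingEnd ℂ w ^ 2).re * t ^ 2 := by
  obtain ⟨a1, a2⟩ := h0
  obtain ⟨b1, b2, b3, b4⟩ := h1
  obtain ⟨c1, c2, c3, c4⟩ := h2
  obtain ⟨d1, d2, d3, d4⟩ := h3
  obtain ⟨f1, f2⟩ := h4
  simp only [quarticForm, Fin.sum_univ_two, a1, a2, b1, b2, b3, b4, c1, c2, c3, c4, d1, d2, d3, d4,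
    f1, f2, Matrix.cons_val_zero, Matrix.cons_val_one]
  simp [normSq_apply, pow_two]
  ring

/-- If the quartic form is largest at the first basis vector and pinched from below, the reaction
term of the Laplacian is positive. -/
theorem reaction_pos (h : IsKahlerTensor S) {a c : ℝ} (ha : S 0 0 0 0 = a) (ha0 : 0 < a)
    (hc0 : 0 ≤ c) (hc : c < (1 + √3) / 2)
    (hmax : ∀ z : Fin 2 → ℂ, (quarticForm S z).re ≤ a * (normSq (z 0) + normSq (z 1)) ^ 2)
    (hmin : ∀ z : Fin 2 → ℂ, -(c * a * (normSq (z 0) + normSq (z 1)) ^ 2) ≤ (quarticForm S z).re) :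
    0 < (2 * ∑ k, ∑ l, S 0 0 k l * S 0 0 l k
      - ∑ k, ∑ l, S k 0 0 l * starRingEnd ℂ (S k 0 0 l)).re := by
  obtain ⟨a', β, γ, h0, h1, h2, h3, h4⟩ := h.exists_components
  obtain rfl : a' = a := by exact_mod_cast h0.1.symm.trans ha
  have hQ := re_quarticForm h0 h1 h2 h3 h4
  -- First-order condition at the maximum: in the comparison with `a'(1 + t²)²` the terms of degree
  -- 0 and 4 cancel, leaving a cubic without constant term.
  have hβw : ∀ w : ℂ, normSq w = 1 → (β * starRingEnd ℂ w).re = 0 := by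
    intro w hw
    have : 4 * (β * starRingEnd ℂ w).re = 0 := by
      refine linear_coeff_eq_zero (q := 2 * (γ * starRingEnd ℂ w ^ 2).re - 6 * a')
        (r := -4 * (β * starRingEnd ℂ w).re) fun t => ?_
      have h5 := hmax ![1, t * w]
      rw [hQ] at h5
      simp only [Matrix.cons_val_zero, Matrix.cons_val_one, normSq_mul, normSq_ofReal, map_one, hw]
        at h5
      nlinarith [h5]
    linarith
  have hβ : β = 0 := by
    have r1 := hβw 1 (by simp)
    have r2 := hβw I (by simp)
    simp at r1 r2
    exact Complex.ext r1 r2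
  have hγ : ‖γ‖ ≤ (2 * c - 1) * a' := by
    -- The unit phase that makes `γ w̄²` equal to `-‖γ‖`, its most negative value. There the form is
    -- `-2a' - 2‖γ‖`, to be compared with the lower bound `-4ca'`.
    let w : ℂ := I * exp ((γ.arg / 2 : ℝ) * I)
    have hw : normSq w = 1 := by
      rw [normSq_eq_norm_sq, norm_mul, norm_exp_ofReal_mul_I]
      simp
    have hw2 : γ * starRingEnd ℂ w ^ 2 = -‖γ‖ := by
      conv_lhs => rw [← norm_mul_exp_arg_mul_I γ]
      simp only [w, map_mul, conj_I, mul_pow, ← exp_conj, conj_ofReal, neg_sq, I_sq, ← exp_nat_mul]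
      rw [mul_assoc, neg_one_mul, mul_neg, ← exp_add]
      simp
      ring_nf
      simp
    have h5 := hmin ![1, (1 : ℝ) * w]
    rw [hQ] at h5
    simp only [hβ, hw2, hw] at h5
    simp [hw] at h5
    nlinarith [h5]
  -- With `β = 0` the first sum contributes `4a'²` and the second `a'² + ‖γ‖²`, so the claim is
  -- `‖γ‖² < 3a'²`.
  simp only [Fin.sum_univ_two, h0.1, h1.1, h2.1, h2.2.1, h3.1, h4.1, hβ]
  simp [mul_conj]
  rw [normSq_eq_norm_sq]
  -- This is where the threshold `(1 + √3)/2` enters; the lower side uses only `0 ≤ c` and `1 < √3`.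
  have h6 : (2 * c - 1) ^ 2 < 3 := by
    have h7 : 2 * c - 1 < √3 := by linarith
    have h8 : -√3 < 2 * c - 1 := by
      have : (1 : ℝ) < √3 := by
        rw [Real.lt_sqrt] <;> norm_num
      linarith
    have := sq_lt_sq' h8 h7
    rwa [Real.sq_sqrt (by norm_num)] at this
  have h9 : ‖γ‖ ^ 2 ≤ (2 * c - 1) ^ 2 * a' ^ 2 := by
    rw [← mul_pow]
    exact pow_le_pow_left₀ (norm_nonneg _) hγ 2
  nlinarith [mul_pos ha0 ha0]

/-- Polarization by hand: `t = 0` yields `a`, and a few values of `t` with `w = 1`, `I`, `1 + I`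
yield the real and imaginary parts of `β` and `γ`. -/
theorem eq_zero (h : IsKahlerTensor S) (h0 : ∀ z : Fin 2 → ℂ, (quarticForm S z).re = 0) :
    ∀ b i j l, S b i j l = 0 := by
  obtain ⟨a, β, γ, h1, h2, h3, h4, h5⟩ := h.exists_components
  have hQ := re_quarticForm h1 h2 h3 h4 h5
  simp only [h0] at hQ
  have ha : a = 0 := by simpa using (hQ 0 0).symm
  subst ha
  have r1 := hQ 1 1
  have r2 := hQ 2 1
  have r3 := hQ 1 (1 + I)
  have r4 := hQ 1 I
  have r5 := hQ 2 I
  simp [normSq_apply, pow_two] at r1 r2 r3 r4 r5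
  have hβ : β = 0 := Complex.ext (by simp; linarith) (by simp; linarith)
  have hγ : γ = 0 := Complex.ext (by simp; linarith) (by
    subst hβ
    simp at r3 ⊢
    linarith)
  subst hβ hγ
  intro b i j l
  fin_cases b <;> fin_cases i <;> fin_cases j <;> fin_cases l <;> simp [h1, h2, h3, h4, h5]

end IsKahlerTensor

end CurvatureAlgebra

/-! ### The Hermitian form and curvature components in a complex basis. -/

section Frame

open Complex TopologicalSpace

variable {E : Type*} [NormedAddCommGroup E] [NormedSpace ℂ E]

/-- The Hermitian form of a Hermitian metric. -/
def hermForm (G : E → E →L[ℝ] E →L[ℝ] ℝ) (x u v : E) : ℂ := G x u v + I * G x u (I • v)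

variable {G : E → E →L[ℝ] E →L[ℝ] ℝ}

theorem hermForm_re (x u v : E) : (hermForm G x u v).re = G x u v := by simp [hermForm]

theorem smul_eq_re_add_im (c : ℂ) (u : E) : c • u = c.re • u + c.im • (I • u) := by
  conv_lhs => rw [← re_add_im c]
  rw [add_smul, mul_smul]
  rfl

theorem hermForm_add_left (x u u' v : E) :
    hermForm G x (u + u') v = hermForm G x u v + hermForm G x u' v := by
  simp [hermForm]
  ring

theorem hermForm_add_right (x u v v' : E) :
    hermForm G x u (v + v') = hermForm G x u v + hermForm G x u v' := by
  simp [hermForm]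
  ring

theorem dbarChristoffel_add (x b v w w' : E) :
    dbarChristoffel G x b v (w + w') = dbarChristoffel G x b v w + dbarChristoffel G x b v w' := by
  simp only [dbarChristoffel, map_add]
  module

theorem dbarChristoffel_add_left (x b b' v w : E) :
    dbarChristoffel G x (b + b') v w = dbarChristoffel G x b v w + dbarChristoffel G x b' v w := by
  simp only [dbarChristoffel, map_add, smul_add, add_apply]
  module

theorem dbarChristoffel_smul_left (x : E) (c : ℂ) (b v w : E) :
    dbarChristoffel G x (c • b) v w = starRingEnd ℂ c • dbarChristoffel G x b v w := by
  have hI : dbarChristoffel G x (I • b) v w = -I • dbarChristoffel G x b v w := by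
    simp only [dbarChristoffel, smul_smul, I_mul_I, neg_one_smul, map_neg, neg_apply]
    match_scalars
    · linear_combination (1 / 2 : ℂ) * I_mul_I
    · ring
  have hr : ∀ (r : ℝ) (b : E), dbarChristoffel G x (r • b) v w = r • dbarChristoffel G x b v w := by
    intro r b
    simp only [dbarChristoffel, smul_comm I r, map_smul, smul_apply]
    module
  rw [smul_eq_re_add_im c b, dbarChristoffel_add_left, hr, hr, hI, smul_eq_re_add_im (starRingEnd ℂ c)]
  simp

/-- The components of the curvature in the frame `e`. -/
def curvatureComponent (G : E → E →L[ℝ] E →L[ℝ] ℝ) (e : Module.Basis (Fin 2) ℂ E) (x : E)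
    (b i j l : Fin 2) : ℂ :=
  e.repr (dbarChristoffel G x (e b) (e i) (e j)) l

namespace IsKahlerOn

variable {U : Set E}

theorem hermForm_conj (h : IsKahlerOn G U) {x : E} (hx : x ∈ U) (u v : E) :
    starRingEnd ℂ (hermForm G x u v) = hermForm G x v u := by
  apply Complex.ext
  · simp [hermForm, h.symm x hx u v]
  · simp [hermForm, h.symm x hx v (I • u), h.apply_I_left hx u v]

theorem hermForm_smul_left (h : IsKahlerOn G U) {x : E} (hx : x ∈ U) (c : ℂ) (u v : E) :
    hermForm G x (c • u) v = c * hermForm G x u v := by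
  rw [smul_eq_re_add_im c u]
  apply Complex.ext
  · simp [hermForm, h.apply_I_left hx u v]
    ring
  · simp [hermForm, h.hermitian x hx u v]

theorem hermForm_smul_right (h : IsKahlerOn G U) {x : E} (hx : x ∈ U) (c : ℂ) (u v : E) :
    hermForm G x u (c • v) = starRingEnd ℂ c * hermForm G x u v := by
  rw [← h.hermForm_conj hx, h.hermForm_smul_left hx, map_mul, h.hermForm_conj hx]

theorem hermForm_self (h : IsKahlerOn G U) {x : E} (hx : x ∈ U) (u : E) :
    hermForm G x u u = G x u u := by
  simp [hermForm, h.apply_I_self hx]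

theorem hermForm_sum_left (h : IsKahlerOn G U) {x : E} (hx : x ∈ U)
    (e : Module.Basis (Fin 2) ℂ E) (u v : E) :
    hermForm G x u v = ∑ l, e.repr u l * hermForm G x (e l) v := by
  conv_lhs => rw [← e.sum_repr u]
  simp only [Fin.sum_univ_two, hermForm_add_left, h.hermForm_smul_left hx]

theorem hermForm_sum_right (h : IsKahlerOn G U) {x : E} (hx : x ∈ U)
    (e : Module.Basis (Fin 2) ℂ E) (u v : E) :
    hermForm G x u v = ∑ l, starRingEnd ℂ (e.repr v l) * hermForm G x u (e l) := by
  conv_lhs => rw [← e.sum_repr v]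
  simp only [Fin.sum_univ_two, hermForm_add_right, h.hermForm_smul_right hx]

variable [FiniteDimensional ℝ E]

theorem dbarChristoffel_symm (h : IsKahlerOn G U) {x : E} (hx : x ∈ U) (b v w : E) :
    dbarChristoffel G x b v w = dbarChristoffel G x b w v := by
  simp only [dbarChristoffel, h.fderiv_christoffel_symm hx _ v w]

theorem dbarChristoffel_smul (h : IsKahlerOn G U) {x : E} (hx : x ∈ U) (c : ℂ) (b v w : E) :
    dbarChristoffel G x b v (c • w) = c • dbarChristoffel G x b v w := by
  rw [smul_eq_re_add_im c w, smul_eq_re_add_im c (dbarChristoffel G x b v w),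
    dbarChristoffel_add, ← h.dbarChristoffel_I_right hx]
  simp only [dbarChristoffel, map_smul]
  module

theorem dbarChristoffel_eq_zero (h : IsKahlerOn G U) {x : E} (hx : x ∈ U)
    (e : Module.Basis (Fin 2) ℂ E) (h0 : ∀ b i j l, curvatureComponent G e x b i j l = 0)
    (b v w : E) : dbarChristoffel G x b v w = 0 := by
  have h1 : ∀ b i j, dbarChristoffel G x (e b) (e i) (e j) = 0 := by
    intro b i j
    apply e.repr.injective
    ext l
    rw [map_zero]
    exact h0 b i j l
  rw [← e.sum_repr b, ← e.sum_repr v, ← e.sum_repr w]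
  simp only [Fin.sum_univ_two, dbarChristoffel_add_left, dbarChristoffel_smul_left,
    dbarChristoffel_add, h.dbarChristoffel_smul hx, h.dbarChristoffel_symm hx (e _) (_ + _),
    h1]
  simp

/-- `∂̄Γ` is antilinear in its first slot and linear in the other two, and in a unitary basis
pairing with `e l` reads off the `l`-th coordinate. -/
theorem hermForm_dbarChristoffel (h : IsKahlerOn G U) {x : E} (hx : x ∈ U)
    (e : Module.Basis (Fin 2) ℂ E)
    (he : ∀ i j, hermForm G x (e i) (e j) = if i = j then 1 else 0) (u : E) :
    hermForm G x (dbarChristoffel G x u u u) u =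
      quarticForm (curvatureComponent G e x) (fun i => e.repr u i) := by
  have hcoord : ∀ w l, hermForm G x w (e l) = e.repr w l := by
    intro w l
    rw [h.hermForm_sum_left hx e]
    simp [he]
  rw [h.hermForm_sum_right hx e]
  simp only [hcoord]
  have hexp : dbarChristoffel G x u u u = ∑ b, ∑ i, ∑ j,
      (starRingEnd ℂ (e.repr u b) * e.repr u i * e.repr u j) •
        dbarChristoffel G x (e b) (e i) (e j) := by
    conv_lhs => rw [← e.sum_repr u]
    simp only [Fin.sum_univ_two, dbarChristoffel_add_left, dbarChristoffel_smul_left,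
      dbarChristoffel_add, h.dbarChristoffel_smul hx, h.dbarChristoffel_symm hx (e _) (_ + _)]
    module
  simp only [hexp, quarticForm, curvatureComponent, Fin.sum_univ_two, map_add, map_smul,
    Finsupp.add_apply, Finsupp.smul_apply, smul_eq_mul]
  ring

end IsKahlerOn

end Frame

/-! ### The maximum principle at the centre of normal coordinates. -/

section MaximumPrinciple

open Complex TopologicalSpace

variable {E : Type*} [NormedAddCommGroup E] [NormedSpace ℂ E]
  {G : E → E →L[ℝ] E →L[ℝ] ℝ}

namespace IsKahlerOn

theorem contDiffOn_hermForm {U : Set E} (h : IsKahlerOn G U) (u v : E) :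
    ContDiffOn ℝ ∞ (fun x => hermForm G x u v) U := by
  have h1 : ∀ w, ContDiffOn ℝ ∞ (fun x => ((G x u w : ℝ) : ℂ)) U := fun w =>
    ofRealCLM.contDiff.comp_contDiffOn
      ((h.smooth.clm_apply contDiffOn_const).clm_apply contDiffOn_const)
  exact (h1 v).add (contDiffOn_const.mul (h1 (I • v)))

variable {U : Opens E}

/-- The components of the metric, as smooth functions. -/
def metricComponent (h : IsKahlerOn G (U : Set E)) (e : Module.Basis (Fin 2) ℂ E) (i j : Fin 2) :
    smoothAlgebra U :=
  toSmooth (fun x => hermForm G x (e i) (e j)) (h.contDiffOn_hermForm _ _)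

theorem metricComponent_apply (h : IsKahlerOn G (U : Set E)) (e : Module.Basis (Fin 2) ℂ E)
    (i j : Fin 2) (x : U) : (h.metricComponent e i j).1 x = hermForm G x (e i) (e j) := rfl

theorem evalAt_metricComponent (h : IsKahlerOn G (U : Set E))
    (e : Module.Basis (Fin 2) ℂ E) {x : U}
    (he : ∀ i j, hermForm G x (e i) (e j) = if i = j then 1 else 0)
    (i j : Fin 2) :
    evalAt x (h.metricComponent e i j) = if i = j then 1 else 0 := he i j

/-- The squared length of a vector in a unitary frame. -/
theorem apply_self_eq (h : IsKahlerOn G (U : Set E)) (e : Module.Basis (Fin 2) ℂ E) {x : U}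
    (he : ∀ i j, hermForm G x (e i) (e j) = if i = j then 1 else 0) (u : E) :
    G x u u = normSq (e.repr u 0) + normSq (e.repr u 1) := by
  rw [← hermForm_re, h.hermForm_sum_left x.2 e, Fin.sum_univ_two, h.hermForm_sum_right x.2 e _ u,
    h.hermForm_sum_right x.2 e _ u]
  simp [he, normSq_apply]

variable [FiniteDimensional ℝ E]

/-- The coordinates of a complex basis, as continuous real linear maps. -/
def _root_.coordReal (e : Module.Basis (Fin 2) ℂ E) (l : Fin 2) : E →L[ℝ] ℂ :=
  LinearMap.toContinuousLinearMap ((e.coord l).restrictScalars ℝ)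

theorem _root_.coordReal_apply (e : Module.Basis (Fin 2) ℂ E) (l : Fin 2) (u : E) :
    coordReal e l u = e.repr u l := rfl

/-- The components of the Christoffel symbols, as smooth functions. -/
def christoffelComponent (h : IsKahlerOn G (U : Set E)) (e : Module.Basis (Fin 2) ℂ E)
    (i j l : Fin 2) : smoothAlgebra U :=
  toSmooth (fun x => coordReal e l (christoffelCLM G x (e i) (e j)))
    ((coordReal e l).contDiff.comp_contDiffOn
      ((h.contDiffOn_christoffelCLM.clm_apply contDiffOn_const).clm_apply contDiffOn_const))

/-- The conjugates of the components of the Christoffel symbols. -/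
def conjChristoffelComponent (h : IsKahlerOn G (U : Set E)) (e : Module.Basis (Fin 2) ℂ E)
    (i j l : Fin 2) : smoothAlgebra U :=
  toSmooth (fun x => conjCLE (coordReal e l (christoffelCLM G x (e i) (e j))))
    (conjCLE.contDiff.comp_contDiffOn ((coordReal e l).contDiff.comp_contDiffOn
      ((h.contDiffOn_christoffelCLM.clm_apply contDiffOn_const).clm_apply contDiffOn_const)))

/-- The connection is metric and commutes with `I`, so the whole Hermitian form is parallel. -/
theorem fderiv_hermForm {U : Set E} (h : IsKahlerOn G U) {x : E} (hx : x ∈ U) (a u v : E) :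
    fderiv ℝ (fun x => hermForm G x u v) x a =
      hermForm G x (christoffelCLM G x a u) v + hermForm G x u (christoffelCLM G x a v) := by
  have hd := h.differentiableAt hx
  have h1 : ∀ w, HasFDerivAt (fun x => ((G x u w : ℝ) : ℂ))
      (ofRealCLM.comp (fderiv ℝ (fun x => G x u w) x)) x := fun w =>
    ofRealCLM.hasFDerivAt.comp x (by fun_prop : DifferentiableAt ℝ (fun x => G x u w) x).hasFDerivAt
  have h2 := ((h1 v).add ((h1 (I • v)).const_mul I)).fderiv
  have h3 := congrArg (fun l => l a) h2
  refine h3.trans ?_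
  simp only [add_apply, smul_apply, ContinuousLinearMap.comp_apply, fderiv_apply_const₂ hd,
    h.fderiv_eq hx, ofRealCLM_apply, smul_eq_mul, hermForm, ← christoffelCLM_apply,
    h.christoffel_I x hx]
  push_cast
  ring

/-- In `fderiv_hermForm` the first term is complex linear in the direction and the second
antilinear; `∂` keeps the first. The companion lemma for `∂̄` keeps the second. -/
theorem wirtinger_metricComponent (h : IsKahlerOn G (U : Set E))
    (e : Module.Basis (Fin 2) ℂ E)
    (k i j : Fin 2) :
    wirtinger (-I) (e k) (h.metricComponent e i j) =
      ∑ l, h.christoffelComponent e k i l * h.metricComponent e l j := by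
  ext x
  rw [wirtinger_apply (-I) (e k) (g := fun x => hermForm G x (e i) (e j))
    (h.metricComponent_apply e i j), h.fderiv_hermForm x.2,
    h.fderiv_hermForm x.2, h.christoffel_I_left x.2, h.christoffel_I_left x.2,
    h.hermForm_smul_left x.2, h.hermForm_smul_right x.2]
  have h1 : (∑ l, h.christoffelComponent e k i l * h.metricComponent e l j).1 x =
      hermForm G x (christoffelCLM G x (e k) (e i)) (e j) := by
    rw [h.hermForm_sum_left x.2 e, ← evalAt_apply, map_sum]
    rfl
  rw [h1, conj_I]
  linear_combination (1 / 2 : ℂ) * (-(hermForm G x (christoffelCLM G x (e k) (e i)) (e j)) +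
    hermForm G x (e i) (christoffelCLM G x (e k) (e j))) * I_mul_I

theorem wirtinger_conj_metricComponent (h : IsKahlerOn G (U : Set E))
    (e : Module.Basis (Fin 2) ℂ E)
    (k i j : Fin 2) :
    wirtinger I (e k) (h.metricComponent e i j) =
      ∑ l, h.conjChristoffelComponent e k j l * h.metricComponent e i l := by
  ext x
  rw [wirtinger_apply I (e k) (g := fun x => hermForm G x (e i) (e j))
    (h.metricComponent_apply e i j), h.fderiv_hermForm x.2,
    h.fderiv_hermForm x.2, h.christoffel_I_left x.2, h.christoffel_I_left x.2,
    h.hermForm_smul_left x.2, h.hermForm_smul_right x.2]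
  have h1 : (∑ l, h.conjChristoffelComponent e k j l * h.metricComponent e i l).1 x =
      hermForm G x (e i) (christoffelCLM G x (e k) (e j)) := by
    rw [h.hermForm_sum_right x.2 e, ← evalAt_apply, map_sum]
    rfl
  rw [h1, conj_I]
  linear_combination (1 / 2 : ℂ) * ((hermForm G x (christoffelCLM G x (e k) (e i)) (e j)) -
    hermForm G x (e i) (christoffelCLM G x (e k) (e j))) * I_mul_I

theorem wirtinger_christoffelComponent (h : IsKahlerOn G (U : Set E))
    (e : Module.Basis (Fin 2) ℂ E)
    (b i j l : Fin 2) (x : U) :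
    (wirtinger I (e b) (h.christoffelComponent e i j l)).1 x =
      curvatureComponent G e x b i j l := by
  have hd := h.differentiableAt_christoffelCLM x.2
  have h1 : ∀ a, fderiv ℝ (fun x => coordReal e l (christoffelCLM G x (e i) (e j))) x a =
      coordReal e l (fderiv ℝ (christoffelCLM G) x a (e i) (e j)) := by
    intro a
    rw [← fderiv_apply_const₂ hd]
    exact congrArg (fun l => l a) ((coordReal e l).hasFDerivAt.comp (x : E) (by fun_prop :
      DifferentiableAt ℝ (fun x => christoffelCLM G x (e i) (e j)) x).hasFDerivAt).fderiv
  rw [wirtinger_apply I (e b)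
    (g := fun x => coordReal e l (christoffelCLM G x (e i) (e j))) (fun _ => rfl), h1, h1]
  simp [curvatureComponent, dbarChristoffel, coordReal_apply, mul_add]

theorem christoffelComponent_symm (h : IsKahlerOn G (U : Set E))
    (e : Module.Basis (Fin 2) ℂ E)
    (i j l : Fin 2) :
    h.christoffelComponent e i j l = h.christoffelComponent e j i l := by
  ext x
  exact congrArg (coordReal e l) (h.christoffelCLM_symm x.2 (e i) (e j))

theorem conjChristoffelComponent_symm (h : IsKahlerOn G (U : Set E))
    (e : Module.Basis (Fin 2) ℂ E)
    (i j l : Fin 2) :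
    h.conjChristoffelComponent e i j l = h.conjChristoffelComponent e j i l := by
  ext x
  exact congrArg (fun z => conjCLE (coordReal e l z)) (h.christoffelCLM_symm x.2 (e i) (e j))

theorem evalAt_christoffelComponent (h : IsKahlerOn G (U : Set E))
    (e : Module.Basis (Fin 2) ℂ E) {x : U} (hΓ : christoffelCLM G x = 0)
    (i j l : Fin 2) :
    evalAt x (h.christoffelComponent e i j l) = 0 := by
  change coordReal e l (christoffelCLM G x (e i) (e j)) = 0
  simp [hΓ]

theorem evalAt_conjChristoffelComponent (h : IsKahlerOn G (U : Set E))
    (e : Module.Basis (Fin 2) ℂ E) {x : U} (hΓ : christoffelCLM G x = 0)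
    (i j l : Fin 2) :
    evalAt x (h.conjChristoffelComponent e i j l) = 0 := by
  change conjCLE (coordReal e l (christoffelCLM G x (e i) (e j))) = 0
  simp [hΓ]

theorem evalAt_wirtinger_conj_metricComponent (h : IsKahlerOn G (U : Set E))
    (e : Module.Basis (Fin 2) ℂ E) {x : U} (hΓ : christoffelCLM G x = 0)
    (k i j : Fin 2) :
    evalAt x (wirtinger I (e k) (h.metricComponent e i j)) = 0 := by
  rw [h.wirtinger_conj_metricComponent, map_sum]
  simp [h.evalAt_conjChristoffelComponent e hΓ]

theorem evalAt_wirtinger_metricComponent (h : IsKahlerOn G (U : Set E))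
    (e : Module.Basis (Fin 2) ℂ E) {x : U} (hΓ : christoffelCLM G x = 0)
    (k i j : Fin 2) :
    evalAt x (wirtinger (-I) (e k) (h.metricComponent e i j)) = 0 := by
  rw [h.wirtinger_metricComponent, map_sum]
  simp [h.evalAt_christoffelComponent e hΓ]

/-- In normal coordinates the curvature consists of the mixed second derivatives of the metric. -/
theorem curvatureComponent_eq (h : IsKahlerOn G (U : Set E))
    (e : Module.Basis (Fin 2) ℂ E) {x : U} (hΓ : christoffelCLM G x = 0)
    (he : ∀ i j, hermForm G x (e i) (e j) = if i = j then 1 else 0)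
    (b k i j : Fin 2) : curvatureComponent G e x b k i j =
    evalAt x (wirtinger I (e b) (wirtinger (-I) (e k) (h.metricComponent e i j))) := by
  rw [h.wirtinger_metricComponent, map_sum, map_sum]
  simp only [Derivation.leibniz, smul_eq_mul, map_add, map_mul,
    h.evalAt_christoffelComponent e hΓ, h.evalAt_metricComponent e he, zero_mul, zero_add]
  simp [evalAt_apply, h.wirtinger_christoffelComponent]

/-- With the curvature written as `∂̄_b ∂_i h_{jl}`, the outer symmetry comes from commuting the
derivatives and from `∂̄_b h_{jl} = ∂̄_l h_{jb}`, and the conjugation rule from `h` being Hermitian.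
The middle symmetry is that of `Γ`, and the trace is Ricci-flatness. -/
theorem isKahlerTensor (h : IsKahlerOn G (U : Set E))
    (e : Module.Basis (Fin 2) ℂ E) {x : U} (hΓ : christoffelCLM G x = 0)
    (he : ∀ i j, hermForm G x (e i) (e j) = if i = j then 1 else 0)
    [FiniteDimensional ℂ E] (hric : ∀ v w, ricci G x v w = 0) :
    IsKahlerTensor (curvatureComponent G e x) where
  symm_mid b i j l := by rw [curvatureComponent, h.dbarChristoffel_symm x.2, curvatureComponent]
  symm_out b i j l := by
    rw [h.curvatureComponent_eq e hΓ he, h.curvatureComponent_eq e hΓ he, wirtinger_comm,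
      h.wirtinger_conj_metricComponent, wirtinger_comm, h.wirtinger_conj_metricComponent]
    simp only [h.conjChristoffelComponent_symm e b l]
  conj b i j l := by
    rw [h.curvatureComponent_eq e hΓ he, h.curvatureComponent_eq e hΓ he]
    have h1 : ∀ y, (wirtinger I (e i) (h.metricComponent e l j)).1 y =
        starRingEnd ℂ ((wirtinger (-I) (e i) (h.metricComponent e j l)).1 y) := by
      intro y
      have := wirtinger_conj I (e i) (f := h.metricComponent e j l) (g := h.metricComponent e l j)
        (fun y => (h.hermForm_conj y.2 _ _).symm) y
      rw [conj_I] at this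
      exact this
    rw [wirtinger_comm I (-I) (e i) (e b), wirtinger_conj (-I) (e b) h1, map_neg, conj_I, neg_neg]
  trace b i := by
    simp only [curvatureComponent, h.dbarChristoffel_symm x.2 _ (e i)]
    exact h.sum_repr_dbarChristoffel x.2 hric e (e b) (e i)

/-- Because of the factor `-2`, a minimum of the holomorphic sectional curvature is a maximum of the
quartic form on unit vectors. -/
theorem re_quarticForm_curvatureComponent (h : IsKahlerOn G (U : Set E))
    (e : Module.Basis (Fin 2) ℂ E)
    {x : U}
    (he : ∀ i j, hermForm G x (e i) (e j) = if i = j then 1 else 0) (u : E) :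
    G x (curvature G x u (I • u) (I • u)) u =
      -2 * (quarticForm (curvatureComponent G e x) (fun i => e.repr u i)).re := by
  rw [← h.hermForm_dbarChristoffel x.2 e he, h.curvature_I x.2, ← hermForm_re,
    h.hermForm_smul_left x.2]
  simp

/-- The smooth function `-½ R(e₀, i e₀, i e₀, e₀)`. -/
def curvatureFunction (h : IsKahlerOn G (U : Set E)) (e : Module.Basis (Fin 2) ℂ E) :
    smoothAlgebra U :=
  ∑ l, wirtinger I (e 0) (h.christoffelComponent e 0 0 l) * h.metricComponent e l 0

theorem curvatureFunction_apply (h : IsKahlerOn G (U : Set E)) (e : Module.Basis (Fin 2) ℂ E)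
    (y : U) : (h.curvatureFunction e).1 y =
      hermForm G y (dbarChristoffel G y (e 0) (e 0) (e 0)) (e 0) := by
  rw [h.hermForm_sum_left y.2 e, ← evalAt_apply, curvatureFunction, map_sum]
  refine Finset.sum_congr rfl fun l _ => ?_
  rw [map_mul, evalAt_apply, evalAt_apply, h.wirtinger_christoffelComponent,
    h.metricComponent_apply]
  rfl

/-- The geometric instance of `laplacian_dbar_christoffel`. Ricci-flatness is required on all of
`U`, since the vanishing trace is differentiated further. -/
theorem laplacian_curvatureFunction [FiniteDimensional ℂ E] (h : IsKahlerOn G (U : Set E))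
    (e : Module.Basis (Fin 2) ℂ E) {x : U} (hΓ : christoffelCLM G x = 0)
    (he : ∀ i j, hermForm G x (e i) (e j) = if i = j then 1 else 0)
    (hric : ∀ y ∈ U, ∀ v w, ricci G y v w = 0) :
    evalAt x (∑ k, wirtinger (-I) (e k) (wirtinger I (e k) (h.curvatureFunction e))) =
      2 * ∑ k, ∑ l, curvatureComponent G e x 0 0 k l * curvatureComponent G e x 0 0 l k
      - ∑ k, ∑ l, curvatureComponent G e x k 0 0 l *
        starRingEnd ℂ (curvatureComponent G e x k 0 0 l) := by
  have htr : ∀ k j, wirtinger I (e k) (∑ l, h.christoffelComponent e j l l) = 0 := by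
    intro k j
    ext y
    rw [map_sum, ← evalAt_apply, map_sum]
    simp only [evalAt_apply, h.wirtinger_christoffelComponent, curvatureComponent,
      h.dbarChristoffel_symm y.2 (e k) (e j)]
    exact h.sum_repr_dbarChristoffel y.2 (hric y y.2) e (e k) (e j)
  have hconj : ∀ k l, evalAt x (wirtinger (-I) (e k) (h.conjChristoffelComponent e 0 0 l)) =
      starRingEnd ℂ (curvatureComponent G e x k 0 0 l) := by
    intro k l
    rw [wirtinger_conj (-I) (e k) (f := h.christoffelComponent e 0 0 l) (fun _ => rfl), map_neg,
      conj_I, neg_neg, evalAt_apply, h.wirtinger_christoffelComponent]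
  have hcomp : ∀ b i j l, evalAt x (wirtinger I (e b) (h.christoffelComponent e i j l)) =
      curvatureComponent G e x b i j l := fun b i j l =>
    h.wirtinger_christoffelComponent e b i j l x
  let d (ε : ℂ) (k : Fin 2) : Derivation ℂ (smoothAlgebra U) (smoothAlgebra U) :=
    wirtinger ε (e k)
  have hcomm : ∀ ε ε' i j f, d ε i (d ε' j f) = d ε' j (d ε i f) := fun ε ε' i j f =>
    wirtinger_comm ε ε' (e i) (e j) f
  have hcore := laplacian_dbar_christoffel (d (-I)) (d I) (hcomm _ _) (hcomm _ _) (hcomm _ _)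
    (evalAt x) (h.metricComponent e)
    (h.christoffelComponent e) (h.conjChristoffelComponent e) (h.christoffelComponent_symm e)
    (h.conjChristoffelComponent_symm e) (h.wirtinger_metricComponent e)
    (h.wirtinger_conj_metricComponent e) htr
    (h.evalAt_metricComponent e he) (h.evalAt_christoffelComponent e hΓ)
    (h.evalAt_conjChristoffelComponent e hΓ)
  simp only [d, hconj, hcomp] at hcore
  exact hcore

/-- At the centre `h₀₀ = 1` and its first derivatives vanish, so `∂ₖ∂̄ₖ h₀₀² = 2 ∂ₖ∂̄ₖ h₀₀`, which
is twice a curvature component; summed over `k` this is a Ricci trace. -/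
theorem laplacian_sq [FiniteDimensional ℂ E] (h : IsKahlerOn G (U : Set E))
    (e : Module.Basis (Fin 2) ℂ E) {x : U} (hΓ : christoffelCLM G x = 0)
    (he : ∀ i j, hermForm G x (e i) (e j) = if i = j then 1 else 0)
    (hric : ∀ v w, ricci G x v w = 0) :
    ∑ k, evalAt x (wirtinger (-I) (e k) (wirtinger I (e k)
      (h.metricComponent e 0 0 * h.metricComponent e 0 0))) = 0 := by
  have hT := h.isKahlerTensor e hΓ he hric
  have h1 : ∀ k, evalAt x (wirtinger (-I) (e k) (wirtinger I (e k)
      (h.metricComponent e 0 0 * h.metricComponent e 0 0))) =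
      2 * curvatureComponent G e x 0 0 k k := by
    intro k
    rw [hT.symm_mid, hT.symm_out, h.curvatureComponent_eq e hΓ he, wirtinger_comm I]
    simp only [Derivation.leibniz, smul_eq_mul, map_add, map_mul,
      h.evalAt_metricComponent e he, h.evalAt_wirtinger_metricComponent e hΓ,
      h.evalAt_wirtinger_conj_metricComponent e hΓ]
    simp
    ring
  simp only [h1, ← Finset.mul_sum, hT.trace, mul_zero]

/-- The holomorphic sectional curvature of a Ricci-flat Kähler surface cannot have a pinched
negative minimum at the centre of normal coordinates. -/
theorem false_of_isMin [FiniteDimensional ℂ E] (h : IsKahlerOn G (U : Set E))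
    (e : Module.Basis (Fin 2) ℂ E) {x : U} (hΓ : christoffelCLM G x = 0)
    (he : ∀ i j, hermForm G x (e i) (e j) = if i = j then 1 else 0)
    (hric : ∀ y ∈ U, ∀ v w, ricci G y v w = 0) {m c : ℝ} (hm : m < 0)
    (hc0 : 0 ≤ c) (hc : c < (1 + √3) / 2)
    (hmin : ∀ y ∈ U, ∀ u, m * G y u u ^ 2 ≤ G y (curvature G y u (I • u) (I • u)) u)
    (heq : G x (curvature G x (e 0) (I • e 0) (I • e 0)) (e 0) = m)
    (hmax : ∀ u, G x (curvature G x u (I • u) (I • u)) u ≤ -c * m * G x u u ^ 2) : False := by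
  have hT := h.isKahlerTensor e hΓ he (hric x x.2)
  have hS : curvatureComponent G e x 0 0 0 0 = ((-m / 2 : ℝ) : ℂ) := by
    have h1 := h.re_quarticForm_curvatureComponent e he (e 0)
    have h2 : quarticForm (curvatureComponent G e x) (fun i => e.repr (e 0) i) =
        curvatureComponent G e x 0 0 0 0 := by
      simp [quarticForm, Fin.sum_univ_two]
    rw [h2, heq] at h1
    have h3 := conj_eq_iff_re.1 (hT.conj 0 0 0 0)
    rw [← h3]
    congr 1
    linarith
  have hvec : ∀ z : Fin 2 → ℂ, ∃ u : E, z = fun i => e.repr u i := fun z =>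
    ⟨e.equivFun.symm z, by ext i; exact (congrFun (e.equivFun.apply_symm_apply z) i).symm⟩
  -- Here `a = -m/2`. The factor `-2` reverses the inequalities: `hmin` bounds the quartic form
  -- above and `hmax` bounds it below.
  have hpos := hT.reaction_pos hS (by linarith) hc0 hc
    (fun z => by
      obtain ⟨u, rfl⟩ := hvec z
      have h1 := hmin x x.2 u
      rw [h.re_quarticForm_curvatureComponent e he, h.apply_self_eq e he] at h1
      linarith)
    (fun z => by
      obtain ⟨u, rfl⟩ := hvec z
      have h1 := hmax u
      rw [h.re_quarticForm_curvatureComponent e he, h.apply_self_eq e he] at h1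
      linarith)
  set F := h.curvatureFunction e with hF
  have hFy := h.curvatureFunction_apply e
  have hcore := h.laplacian_curvatureFunction e hΓ he hric
  have hsq := h.laplacian_sq e hΓ he (hric x x.2)
  -- The constant field `e 0` has unit length only at `x`, so `m` is weighted by `|e₀|⁴`. This keeps
  -- `f` nonnegative near `x`, with value zero at `x`.
  set f : smoothAlgebra U :=
    (-2 : ℂ) • F - (m : ℂ) • (h.metricComponent e 0 0 * h.metricComponent e 0 0) with hf
  have hfy : ∀ y : U, (f.1 y).re =
      G y (curvature G y (e 0) (I • e 0) (I • e 0)) (e 0) - m * G y (e 0) (e 0) ^ 2 := by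
    intro y
    rw [h.curvature_I y.2, ← hermForm_re, h.hermForm_smul_left y.2, ← hFy]
    change ((-2 : ℂ) * F.1 y - (m : ℂ) * (hermForm G y (e 0) (e 0) * hermForm G y (e 0) (e 0))).re
      = _
    rw [h.hermForm_self y.2, sub_re, ← ofReal_mul, ← ofReal_mul, ofReal_re]
    ring
  have hlap : ∀ k, 0 ≤ (evalAt x (wirtinger (-I) (e k) (wirtinger I (e k) f))).re := fun k => by
    refine re_wirtinger_wirtinger_nonneg ?_ (fun y => ?_) (e k)
    · have h1 : G x (e 0) (e 0) = 1 := by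
        rw [← hermForm_re, he]
        simp
      rw [hfy, heq, h1]
      ring
    · rw [hfy, sub_nonneg]
      exact hmin y y.2 (e 0)
  have hsum : (∑ k, evalAt x (wirtinger (-I) (e k) (wirtinger I (e k) f))).re =
      -2 * (evalAt x (∑ k, wirtinger (-I) (e k) (wirtinger I (e k) F))).re := by
    simp only [hf, map_sub, Derivation.map_smul, map_smul, Finset.sum_sub_distrib,
      ← Finset.smul_sum, hsq]
    rw [map_sum]
    simp
  rw [hcore, re_sum] at hsum
  have := Finset.sum_nonneg fun k (_ : k ∈ Finset.univ) => hlap k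
  linarith

/-- If the holomorphic sectional curvature of a Ricci-flat Kähler surface vanishes at the centre of
normal coordinates, then so does the curvature. -/
theorem curvature_eq_zero_of_forall [FiniteDimensional ℂ E] (h : IsKahlerOn G (U : Set E))
    (e : Module.Basis (Fin 2) ℂ E) {x : U} (hΓ : christoffelCLM G x = 0)
    (he : ∀ i j, hermForm G x (e i) (e j) = if i = j then 1 else 0)
    (hric : ∀ v w, ricci G x v w = 0)
    (h0 : ∀ u, G x (curvature G x u (I • u) (I • u)) u = 0) (u v w : E) :
    curvature G x u v w = 0 := by
  have hT := h.isKahlerTensor e hΓ he hric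
  refine h.curvature_eq_zero x.2 (h.dbarChristoffel_eq_zero x.2 e (hT.eq_zero fun z => ?_)) u v w
  have h1 := h.re_quarticForm_curvatureComponent e he (e.equivFun.symm z)
  have h2 : (fun i => e.repr (e.equivFun.symm z) i) = z := e.equivFun.apply_symm_apply z
  rw [h0, h2] at h1
  linarith

end IsKahlerOn

end MaximumPrinciple

/-! ### Unitary frames, normal coordinates, and the pointwise statements freed from them. -/

section NormalCoordinates

open Complex TopologicalSpace

/-- The Ricci curvature is natural under pullback. -/
theorem IsMetricOn.ricci_pullback {E : Type*} [NormedAddCommGroup E] [NormedSpace ℂ E]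
    [FiniteDimensional ℝ E] {G : E → E →L[ℝ] E →L[ℝ] ℝ} {U : Set E} (h : IsMetricOn G U)
    {φ : E → E} {V : Set E} (hV : IsOpen V)
    (hφ : ContDiffOn ℝ ∞ φ V) (hVU : Set.MapsTo φ V U)
    (hinj : ∀ x ∈ V, Function.Injective (fderiv ℝ φ x)) {x : E} (hx : x ∈ V) (v w : E) :
    ricci (pullbackMetric φ G) x v w = ricci G (φ x) (fderiv ℝ φ x v) (fderiv ℝ φ x w) := by
  have hP := h.pullback hV hφ hVU hinj
  rw [h.ricci_eq_trace (hVU hx), hP.ricci_eq_trace hx]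
  let e : E ≃ₗ[ℝ] E := LinearEquiv.ofInjectiveEndo (fderiv ℝ φ x : E →ₗ[ℝ] E) (hinj x hx)
  -- The derivative of `φ` conjugates one Ricci operator into the other, and the trace is invariant
  -- under conjugation.
  rw [← LinearMap.trace_conj' (ricciOperator (pullbackMetric φ G) x v w) e]
  congr 1
  ext u
  obtain ⟨u, rfl⟩ := e.surjective u
  rw [LinearEquiv.conj_apply_apply, LinearEquiv.symm_apply_apply, hP.ricciOperator_apply hx,
    h.ricciOperator_apply (hVU hx)]
  exact h.fderiv_curvature_pullback hV hφ hVU hinj hx u v w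

variable {E : Type*} [NormedAddCommGroup E] [NormedSpace ℂ E]
  {G : E → E →L[ℝ] E →L[ℝ] ℝ} {U : Set E}

namespace IsKahlerOn

/-- Every nonzero vector is a real multiple of the first vector of a unitary frame. -/
theorem exists_unitary_frame [FiniteDimensional ℂ E] (hE : Module.finrank ℂ E = 2)
    (h : IsKahlerOn G U) {x : E} (hx : x ∈ U) {u : E} (hu : u ≠ 0) :
    ∃ e : Module.Basis (Fin 2) ℂ E,
      (∀ i j, hermForm G x (e i) (e j) = if i = j then 1 else 0) ∧
      e 0 = ((√(G x u u))⁻¹ : ℝ) • u := by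
  have hnorm : ∀ v : E, v ≠ 0 → hermForm G x (((√(G x v v))⁻¹ : ℝ) • v)
      (((√(G x v v))⁻¹ : ℝ) • v) = 1 := by
    intro v hv
    have hp := h.pos x hx v hv
    rw [h.hermForm_self hx]
    simp only [map_smul, smul_apply, smul_eq_mul]
    rw [← mul_assoc, ← mul_inv, Real.mul_self_sqrt hp.le, inv_mul_cancel₀ hp.ne', ofReal_one]
  have hr : ∀ (r : ℝ) (v : E), r • v = (r : ℂ) • v := fun _ _ => rfl
  obtain ⟨v, hv⟩ := exists_linearIndependent_pair_of_one_lt_finrank (R := ℂ)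
    (by rw [hE]; norm_num) hu
  set a : E := ((√(G x u u))⁻¹ : ℝ) • u with ha
  have haa : hermForm G x a a = 1 := hnorm u hu
  -- Gram–Schmidt for the Hermitian form.
  set w : E := v - hermForm G x v a • a with hw
  have hw0 : w ≠ 0 := by
    intro h0
    have h1 := LinearIndependent.pair_iff.1 hv
      (-(hermForm G x v a * (((√(G x u u))⁻¹ : ℝ) : ℂ))) 1 (by
        rw [← h0, hw, ha, hr, smul_smul]
        module)
    exact one_ne_zero h1.2
  have hwa : hermForm G x w a = 0 := by
    rw [hw, sub_eq_add_neg, ← neg_smul, hermForm_add_left, h.hermForm_smul_left hx, haa]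
    ring
  set b : E := ((√(G x w w))⁻¹ : ℝ) • w with hb
  have hbb : hermForm G x b b = 1 := hnorm w hw0
  have hba : hermForm G x b a = 0 := by
    rw [hb, hr, h.hermForm_smul_left hx, hwa, mul_zero]
  have hab : hermForm G x a b = 0 := by rw [← h.hermForm_conj hx, hba, map_zero]
  have hli : LinearIndependent ℂ ![a, b] := by
    refine LinearIndependent.pair_iff.2 fun s t hst => ?_
    have h1 : ∀ c, hermForm G x (s • a + t • b) c = s * hermForm G x a c + t * hermForm G x b c := by
      intro c
      rw [hermForm_add_left, h.hermForm_smul_left hx, h.hermForm_smul_left hx]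
    have h0 : ∀ c, hermForm G x 0 c = 0 := fun c => by simp [hermForm]
    have ha := h1 a
    have hb := h1 b
    rw [hst, h0, haa, hba] at ha
    rw [hst, h0, hab, hbb] at hb
    constructor
    · linear_combination -ha
    · linear_combination -hb
  refine ⟨basisOfLinearIndependentOfCardEqFinrank hli (by simp [hE]), fun i j => ?_, by simp⟩
  fin_cases i <;> fin_cases j <;> simp [haa, hab, hba, hbb]

variable [FiniteDimensional ℝ E]

/-- Holomorphic coordinates in which the Christoffel symbols vanish at a given point. -/
theorem exists_normal_coordinates (h : IsKahlerOn G U) {y : E} (hy : y ∈ U) :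
    ∃ (φ : E → E) (V : Set E), IsOpen V ∧ (0 : E) ∈ V ∧ ContDiffOn ℝ ∞ φ V ∧ Set.MapsTo φ V U ∧
      (∀ x ∈ V, Function.Injective (fderiv ℝ φ x)) ∧
      (∀ x ∈ V, ∀ u : E, fderiv ℝ φ x (I • u) = I • fderiv ℝ φ x u) ∧ φ 0 = y ∧
      (∀ u, fderiv ℝ φ 0 u = u) ∧ christoffelCLM (pullbackMetric φ G) 0 = 0 := by
  set B := christoffelCLM G y with hB
  -- The second derivative `-B` cancels `Γ(y)` in the transformation rule. The map is holomorphic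
  -- because the Kähler condition makes `B` complex bilinear.
  let φ : E → E := fun z => y + z - (1 / 2 : ℝ) • B z z
  have hφ : ContDiff ℝ ∞ φ := by
    have h1 : ContDiff ℝ ∞ fun z : E => B z z := B.contDiff.clm_apply contDiff_id
    exact (contDiff_const.add contDiff_id).sub (h1.const_smul _)
  have hfd : fderiv ℝ φ = fun z => ContinuousLinearMap.id ℝ E - B z := by
    ext z w
    have h1 : HasFDerivAt (fun z : E => B z z) ((B z) + B.flip z) z := by
      have := B.hasFDerivAt.clm_apply (hasFDerivAt_id z)
      convert! this using 1
    have h2 : HasFDerivAt φ (ContinuousLinearMap.id ℝ E - (1 / 2 : ℝ) • (B z + B.flip z)) z :=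
      ((hasFDerivAt_id z).const_add y).sub (h1.const_smul (1 / 2 : ℝ))
    rw [h2.fderiv]
    simp only [sub_apply, smul_apply, add_apply, ContinuousLinearMap.flip_apply]
    rw [hB, h.christoffelCLM_symm hy w z]
    module
  have h0 : φ 0 = y := by simp [φ]
  -- The derivative of `φ` at `z` is `id - B z`, which is injective as soon as `‖B z‖ < 1`.
  let V : Set E := φ ⁻¹' U ∩ {z | ‖B z‖ < 1}
  have hV : IsOpen V := (h.isOpen.preimage hφ.continuous).inter
    (isOpen_lt B.continuous.norm continuous_const)
  have h0V : (0 : E) ∈ V := ⟨by rw [Set.mem_preimage, h0]; exact hy, by simp⟩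
  have hinj : ∀ x ∈ V, Function.Injective (fderiv ℝ φ x) := by
    intro x hx
    rw [injective_iff_map_eq_zero]
    intro u hu
    rw [hfd] at hu
    have h1 : u = B x u := by simpa [sub_eq_zero] using hu
    by_contra hne
    have h2 := (B x).le_opNorm u
    rw [← h1] at h2
    have h3 : ‖B x‖ < 1 := hx.2
    have h4 := norm_pos_iff.2 hne
    nlinarith
  refine ⟨φ, V, hV, h0V, hφ.contDiffOn, fun x hx => hx.1, hinj, fun x hx u => ?_, h0, fun u => ?_,
    ?_⟩
  · rw [hfd]
    simp only [sub_apply, ContinuousLinearMap.id_apply, hB, h.christoffel_I y hy, smul_sub]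
  · rw [hfd]
    simp
  · ext u v
    have h1 := h.fderiv_christoffel_pullback hV hφ.contDiffOn (fun x hx => hx.1) hinj h0V u v
    have h2 : fderiv ℝ (fderiv ℝ φ) 0 u v = -B u v := by
      rw [hfd, fderiv_const_sub, B.fderiv]
      simp
    rw [h2, h0, hfd] at h1
    simpa [hB] using h1

/-- The pullback of the quartic curvature form. -/
theorem curvature_form_pullback (h : IsKahlerOn G U) {φ : E → E} {V : Set E} (hV : IsOpen V)
    (hφ : ContDiffOn ℝ ∞ φ V) (hVU : Set.MapsTo φ V U)
    (hinj : ∀ x ∈ V, Function.Injective (fderiv ℝ φ x))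
    (hhol : ∀ x ∈ V, ∀ u : E, fderiv ℝ φ x (I • u) = I • fderiv ℝ φ x u) {x : E} (hx : x ∈ V)
    (u : E) :
    pullbackMetric φ G x (curvature (pullbackMetric φ G) x u (I • u) (I • u)) u =
      G (φ x) (curvature G (φ x) (fderiv ℝ φ x u) (I • fderiv ℝ φ x u) (I • fderiv ℝ φ x u))
        (fderiv ℝ φ x u) := by
  rw [pullbackMetric_apply, h.fderiv_curvature_pullback hV hφ hVU hinj hx, hhol x hx]

theorem curvature_form_smul (h : IsKahlerOn G U) {x : E} (hx : x ∈ U) (r : ℝ) (u : E) :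
    G x (curvature G x (r • u) (I • r • u) (I • r • u)) (r • u) =
      r ^ 4 * G x (curvature G x u (I • u) (I • u)) u := by
  rw [h.curvature_eq hx, h.curvature_eq hx, smul_comm I r]
  simp only [map_smul, smul_apply, ← smul_add, ← smul_sub, smul_eq_mul]
  ring

/-- The holomorphic sectional curvature of a Ricci-flat Kähler surface has no pinched negative
minimum. -/
theorem false_of_pinched_min [FiniteDimensional ℂ E] (hE : Module.finrank ℂ E = 2)
    (h : IsKahlerOn G U) (hric : ∀ y ∈ U, ∀ v w, ricci G y v w = 0) {m c : ℝ} (hm : m < 0)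
    (hc0 : 0 ≤ c) (hc : c < (1 + √3) / 2)
    (hmin : ∀ y ∈ U, ∀ u, m * G y u u ^ 2 ≤ G y (curvature G y u (I • u) (I • u)) u)
    {x : E} (hx : x ∈ U) {u : E} (hu : u ≠ 0)
    (heq : G x (curvature G x u (I • u) (I • u)) u = m * G x u u ^ 2)
    (hmax : ∀ u, G x (curvature G x u (I • u) (I • u)) u ≤ -c * m * G x u u ^ 2) : False := by
  obtain ⟨φ, V, hV, h0V, hφ, hVU, hinj, hhol, h0, hid, hΓ⟩ := h.exists_normal_coordinates hx
  have hP := h.pullback hV hφ hVU hinj hhol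
  obtain ⟨e, he, he0⟩ := hP.exists_unitary_frame hE h0V hu
  have hform := fun {y : E} (hy : y ∈ V) => h.curvature_form_pullback hV hφ hVU hinj hhol hy
  have hG0 : ∀ v w, pullbackMetric φ G 0 v w = G x v w := fun v w => by
    rw [pullbackMetric_apply, hid, hid, h0]
  have hup := h.pos x hx u hu
  refine IsKahlerOn.false_of_isMin (U := ⟨V, hV⟩) hP e (x := ⟨0, h0V⟩) hΓ he
    (fun y hy v w => ?_) hm hc0 hc (fun y hy v => ?_) ?_ (fun v => ?_)
  · rw [h.ricci_pullback hV hφ hVU hinj hy, hric _ (hVU hy)]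
  · rw [hform hy, pullbackMetric_apply]
    exact hmin _ (hVU hy) _
  · rw [he0, hP.curvature_form_smul h0V, hform h0V, hid, h0, heq, hG0]
    have h1 : √(G x u u) ^ 4 = G x u u ^ 2 := by
      rw [show 4 = 2 * 2 from rfl, pow_mul, Real.sq_sqrt hup.le]
    rw [inv_pow, h1]
    field_simp
  · have h1 := hform h0V v
    rw [hid, h0] at h1
    refine h1.trans_le ?_
    rw [hG0]
    exact hmax v

/-- A Ricci-flat Kähler surface is flat at the points where its holomorphic sectional curvature
vanishes. -/
theorem curvature_eq_zero_of_holomorphic [FiniteDimensional ℂ E] (hE : Module.finrank ℂ E = 2)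
    (h : IsKahlerOn G U) {x : E} (hx : x ∈ U) (hric : ∀ v w, ricci G x v w = 0)
    (hzero : ∀ u, G x (curvature G x u (I • u) (I • u)) u = 0) (u v w : E) :
    curvature G x u v w = 0 := by
  obtain ⟨φ, V, hV, h0V, hφ, hVU, hinj, hhol, h0, hid, hΓ⟩ := h.exists_normal_coordinates hx
  have hP := h.pullback hV hφ hVU hinj hhol
  have : Nontrivial E := Module.nontrivial_of_finrank_pos (R := ℂ) (by rw [hE]; norm_num)
  obtain ⟨u₀, hu₀⟩ := exists_ne (0 : E)
  obtain ⟨e, he, -⟩ := hP.exists_unitary_frame hE h0V hu₀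
  have h1 := IsKahlerOn.curvature_eq_zero_of_forall (U := ⟨V, hV⟩) hP e (x := ⟨0, h0V⟩) hΓ he
    (fun v w => by
      rw [h.ricci_pullback hV hφ hVU hinj h0V, h0, hric])
    (fun v => by
      rw [h.curvature_form_pullback hV hφ hVU hinj hhol h0V, hid, h0, hzero]) u v w
  have h2 := h.fderiv_curvature_pullback hV hφ hVU hinj h0V u v w
  rw [h1, map_zero, hid, hid, hid, h0] at h2
  exact h2.symm

end IsKahlerOn

end NormalCoordinates

/-! ### From the manifold to its charts. -/

section ChartMetric

open Complex

variable {E : Type*} [NormedAddCommGroup E] [NormedSpace ℂ E]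
  {M : Type*} [TopologicalSpace M] [ChartedSpace E M] [IsManifold 𝓘(ℂ, E) ω M]

/-- The field is the tangent map of `e.symm` applied to a constant section, hence smooth. -/
theorem contMDiffOn_mfderiv_symm {e : OpenPartialHomeomorph M E} (he : e ∈ atlas E M) (u : E) :
    ContMDiffOn 𝓘(ℝ, E) (𝓘(ℝ, E).prod 𝓘(ℝ, E)) ∞
      (fun y => (Bundle.TotalSpace.mk' E (e.symm y) (mfderiv 𝓘(ℝ, E) 𝓘(ℝ, E) e.symm y u) :
        TangentBundle 𝓘(ℝ, E) M)) e.target := by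
  have h1 : ContMDiffOn 𝓘(ℝ, E) 𝓘(ℝ, E) ω e.symm e.target :=
    contMDiffOn_symm_of_mem_maximalAtlas (IsManifold.subset_maximalAtlas he)
  have h2 := h1.contMDiffOn_tangentMapWithin (m := ∞) (by simp) e.open_target.uniqueMDiffOn
  have h3 : ContMDiff 𝓘(ℝ, E) (𝓘(ℝ, E).prod 𝓘(ℝ, E)) ∞
      (fun y : E => (Bundle.TotalSpace.mk' E y u : TangentBundle 𝓘(ℝ, E) E)) :=
    contMDiff_vectorSpace_iff_contDiff.2 contDiff_const
  have h4 := h2.comp h3.contMDiffOn (s := e.target) (fun y hy => hy)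
  refine h4.congr fun y hy => ?_
  simp only [Function.comp, tangentMapWithin, mfderivWithin_of_isOpen e.open_target hy]

theorem contDiffOn_localMetric_apply (g : SmoothMetric E M) {e : OpenPartialHomeomorph M E}
    (he : e ∈ atlas E M) (u v : E) :
    ContDiffOn ℝ ∞ (fun y => localMetric g e y u v) e.target := by
  have hb : ContMDiffOn 𝓘(ℝ, E) 𝓘(ℝ, E) ∞ e.symm e.target :=
    contMDiffOn_symm_of_mem_maximalAtlas (IsManifold.subset_maximalAtlas he)
  have h1 : ContMDiffOn 𝓘(ℝ, E) (𝓘(ℝ, E).prod 𝓘(ℝ)) ∞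
      (fun y => Bundle.TotalSpace.mk' ℝ (E := Bundle.Trivial M ℝ) (e.symm y)
        (g.inner (e.symm y) (mfderiv 𝓘(ℝ, E) 𝓘(ℝ, E) e.symm y u)
          (mfderiv 𝓘(ℝ, E) 𝓘(ℝ, E) e.symm y v))) e.target := by
    apply ContMDiffOn.clm_bundle_apply₂ (F₁ := E) (F₂ := E)
    · exact g.contMDiff.comp_contMDiffOn hb
    · exact contMDiffOn_mfderiv_symm he u
    · exact contMDiffOn_mfderiv_symm he v
  intro y hy
  have h2 := h1 y hy
  rw [Bundle.contMDiffWithinAt_totalSpace] at h2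
  exact h2.2.contDiffWithinAt

theorem eq_zero_of_mfderiv_symm_eq_zero {e : OpenPartialHomeomorph M E} (he : e ∈ atlas E M)
    {y : E} (hy : y ∈ e.target) {u : E} (h0 : mfderiv 𝓘(ℝ, E) 𝓘(ℝ, E) e.symm y u = 0) :
    u = 0 := by
  have hd := mdifferentiable_of_mem_atlas (I := 𝓘(ℝ, E)) he
  have h1 := congrArg (fun l => l u) (hd.comp_symm_deriv hy)
  exact (h1.symm.trans (congrArg (mfderiv 𝓘(ℝ, E) 𝓘(ℝ, E) e (e.symm y)) h0)).trans (map_zero _)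

/-- The change of charts. -/
theorem contDiffOn_chart_change {e e' : OpenPartialHomeomorph M E} (he : e ∈ atlas E M)
    (he' : e' ∈ atlas E M) : ContDiffOn ℂ ω (e' ∘ e.symm) (e.symm.trans e').source := by
  have h := HasGroupoid.compatible (G := contDiffGroupoid ω 𝓘(ℂ, E)) he he'
  rw [contDiffGroupoid, mem_groupoid_of_pregroupoid] at h
  have h1 : ContDiffOn ℂ ω (𝓘(ℂ, E) ∘ (e.symm.trans e') ∘ 𝓘(ℂ, E).symm)
      (𝓘(ℂ, E).symm ⁻¹' (e.symm.trans e').source ∩ Set.range 𝓘(ℂ, E)) := h.1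
  simpa using h1

theorem fderiv_chart_change_I {e e' : OpenPartialHomeomorph M E} (he : e ∈ atlas E M)
    (he' : e' ∈ atlas E M) {y : E} (hy : y ∈ (e.symm.trans e').source) (u : E) :
    fderiv ℝ (e' ∘ e.symm) y (I • u) = I • fderiv ℝ (e' ∘ e.symm) y u := by
  have h1 : DifferentiableAt ℂ (e' ∘ e.symm) y :=
    ((contDiffOn_chart_change he he').contDiffAt
      ((e.symm.trans e').open_source.mem_nhds hy)).differentiableAt (by simp)
  rw [h1.fderiv_restrictScalars ℝ]
  simp

theorem localMetric_eq_pullback (g : SmoothMetric E M) {e e' : OpenPartialHomeomorph M E}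
    (he : e ∈ atlas E M) (he' : e' ∈ atlas E M) :
    Set.EqOn (localMetric g e) (pullbackMetric (e' ∘ e.symm) (localMetric g e'))
      (e.symm.trans e').source := by
  intro y hy
  have hy1 : y ∈ e.target ∧ e.symm y ∈ e'.source := by simpa using hy
  have hd := mdifferentiable_of_mem_atlas (I := 𝓘(ℝ, E)) he
  have hd' := mdifferentiable_of_mem_atlas (I := 𝓘(ℝ, E)) he'
  have hpt : e'.symm (e' (e.symm y)) = e.symm y := e'.left_inv hy1.2
  have hφ : MDifferentiableAt 𝓘(ℝ, E) 𝓘(ℝ, E) (e' ∘ e.symm) y :=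
    (hd'.mdifferentiableAt hy1.2).comp y (hd.mdifferentiableAt_symm hy1.1)
  have hev : e.symm =ᶠ[𝓝 y] e'.symm ∘ (e' ∘ e.symm) := by
    filter_upwards [(e.symm.trans e').open_source.mem_nhds hy] with z hz
    have hz1 : z ∈ e.target ∧ e.symm z ∈ e'.source := by simpa using hz
    exact (e'.left_inv hz1.2).symm
  have hder : ∀ u : E, (mfderiv 𝓘(ℝ, E) 𝓘(ℝ, E) e.symm y u : E) =
      mfderiv 𝓘(ℝ, E) 𝓘(ℝ, E) e'.symm ((e' ∘ e.symm) y) (fderiv ℝ (e' ∘ e.symm) y u) := by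
    intro u
    have h1 := hev.mfderiv_eq (I := 𝓘(ℝ, E)) (I' := 𝓘(ℝ, E))
    have h2 := mfderiv_comp y (I := 𝓘(ℝ, E)) (I' := 𝓘(ℝ, E)) (I'' := 𝓘(ℝ, E))
      (hd'.mdifferentiableAt_symm (e'.map_source hy1.2) :
        MDifferentiableAt 𝓘(ℝ, E) 𝓘(ℝ, E) e'.symm ((e' ∘ e.symm) y)) hφ
    rw [h2] at h1
    have h3 := congrArg (fun l : E →L[ℝ] E => l u) h1
    rw [mfderiv_eq_fderiv] at h3
    exact h3
  -- Tangent spaces at two provably equal points are different types; reading the metric as a form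
  -- on `E` allows the base point to be rewritten.
  let b : M → E →L[ℝ] E →L[ℝ] ℝ := fun p => g.inner p
  have hb : ∀ p q : M, p = q → ∀ a a' c c' : E, a = a' → c = c' → b p a c = b q a' c' := by
    rintro p _ rfl a _ c _ rfl rfl
    rfl
  ext u v
  exact hb _ _ hpt.symm _ _ _ _ (hder u) (hder v)

variable [FiniteDimensional ℝ E]

theorem isMetricOn_localMetric (g : SmoothMetric E M) {e : OpenPartialHomeomorph M E}
    (he : e ∈ atlas E M) : IsMetricOn (localMetric g e) e.target where
  isOpen := e.open_target
  smooth := contDiffOn_clm_apply.2 fun u => contDiffOn_clm_apply.2 fun v =>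
    contDiffOn_localMetric_apply g he u v
  symm y _ u v := by
    rw [localMetric_apply, localMetric_apply]
    exact g.symm _ _ _
  pos y hy u hu := by
    rw [localMetric_apply]
    exact g.pos _ _ fun h0 => hu (eq_zero_of_mfderiv_symm_eq_zero he hy h0)

theorem isKahlerOn_localMetric {g : SmoothMetric E M} (hK : IsKahler g)
    {e : OpenPartialHomeomorph M E} (he : e ∈ atlas E M) :
    IsKahlerOn (localMetric g e) e.target :=
  (isMetricOn_localMetric g he).isKahlerOn (hK.hermitian e he) (hK.closed e he)

end ChartMetric

/-! ### Locality of the curvature. -/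

section Congr

variable {E : Type*} [NormedAddCommGroup E] [NormedSpace ℝ E]
  {G G' : E → E →L[ℝ] E →L[ℝ] ℝ} {U : Set E}

theorem curvature_congr (hU : IsOpen U) (h : Set.EqOn G G' U) {x : E} (hx : x ∈ U) (u v w : E) :
    curvature G x u v w = curvature G' x u v w := by
  have h1 : ∀ a b, Set.EqOn (fun y => christoffel G y a b) (fun y => christoffel G' y a b) U := by
    intro a b y hy
    simp only [christoffel, christoffelForm, h hy, fderiv_eq_of_eqOn hU h hy]
  have h2 : ∀ a b, christoffel G x a b = christoffel G' x a b := fun a b => h1 a b hx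
  rw [curvature, curvature, fderiv_eq_of_eqOn hU (h1 v w) hx, fderiv_eq_of_eqOn hU (h1 u w) hx]
  simp only [h2]

theorem ricci_congr [FiniteDimensional ℝ E] (hU : IsOpen U) (h : Set.EqOn G G' U) {x : E}
    (hx : x ∈ U) (v w : E) : ricci G x v w = ricci G' x v w := by
  simp only [ricci, curvature_congr hU h hx]

end Congr

theorem mapsTo_chart_change {E M : Type*} [TopologicalSpace E] [TopologicalSpace M]
    (e e' : OpenPartialHomeomorph M E) :
    Set.MapsTo (e' ∘ e.symm) (e.symm.trans e').source e'.target := by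
  intro y hy
  have hy1 : y ∈ e.target ∧ e.symm y ∈ e'.source := by simpa using hy
  exact e'.map_source hy1.2

/-! ### Chart independence, and the global minimum by compactness. -/

section Transfer

open Complex

variable {E : Type*} [NormedAddCommGroup E] [NormedSpace ℂ E]

/-- The holomorphic sectional curvature of a metric in a chart. -/
def holSectional (G : E → E →L[ℝ] E →L[ℝ] ℝ) (y u : E) : ℝ := sectional G y u (I • u)

section Continuity

variable {G : E → E →L[ℝ] E →L[ℝ] ℝ} {U : Set E}

theorem IsKahlerOn.holSectional_eq (h : IsKahlerOn G U) {x : E} (hx : x ∈ U) (u : E) :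
    holSectional G x u = G x (curvature G x u (I • u) (I • u)) u / G x u u ^ 2 :=
  h.sectional_I hx u

variable [FiniteDimensional ℝ E]

theorem IsKahlerOn.holSectional_smul (h : IsKahlerOn G U) {x : E} (hx : x ∈ U) {r : ℝ} (hr : r ≠ 0)
    (u : E) : holSectional G x (r • u) = holSectional G x u := by
  rw [h.holSectional_eq hx, h.holSectional_eq hx, h.curvature_form_smul hx]
  simp only [map_smul, smul_apply, smul_eq_mul]
  rw [show (r * (r * G x u u)) ^ 2 = r ^ 4 * G x u u ^ 2 by ring]
  exact mul_div_mul_left _ _ (pow_ne_zero 4 hr)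

theorem IsKahlerOn.continuousOn_holSectional (h : IsKahlerOn G U) :
    ContinuousOn (fun z : E × E => holSectional G z.1 z.2) (U ×ˢ {0}ᶜ) := by
  have hfst : Set.MapsTo (Prod.fst : E × E → E) (U ×ˢ {0}ᶜ) U := fun z hz => hz.1
  have hG : ContinuousOn (fun z : E × E => G z.1) (U ×ˢ {0}ᶜ) :=
    h.smooth.continuousOn.comp continuousOn_fst hfst
  have hΓ : ContinuousOn (fun z : E × E => christoffelCLM G z.1) (U ×ˢ {0}ᶜ) :=
    h.contDiffOn_christoffelCLM.continuousOn.comp continuousOn_fst hfst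
  have hDΓ : ContinuousOn (fun z : E × E => fderiv ℝ (christoffelCLM G) z.1) (U ×ˢ {0}ᶜ) :=
    (contDiffOn_fderiv_of_isOpen h.isOpen h.contDiffOn_christoffelCLM).continuousOn.comp
      continuousOn_fst hfst
  have hu : ContinuousOn (fun z : E × E => z.2) (U ×ˢ {0}ᶜ) := continuousOn_snd
  have hIu : ContinuousOn (fun z : E × E => I • z.2) (U ×ˢ {0}ᶜ) := hu.const_smul I
  have hcurv : ContinuousOn (fun z : E × E => curvature G z.1 z.2 (I • z.2) (I • z.2))
      (U ×ˢ {0}ᶜ) := by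
    refine ContinuousOn.congr ?_ fun z hz => h.curvature_eq (hfst hz) _ _ _
    exact (((((hDΓ.clm_apply hu).clm_apply hIu).clm_apply hIu).sub
      (((hDΓ.clm_apply hIu).clm_apply hu).clm_apply hIu)).add
      ((hΓ.clm_apply hu).clm_apply ((hΓ.clm_apply hIu).clm_apply hIu))).sub
      ((hΓ.clm_apply hIu).clm_apply ((hΓ.clm_apply hu).clm_apply hIu))
  refine ContinuousOn.congr ?_ fun z hz => h.holSectional_eq (hfst hz) _
  exact ((hG.clm_apply hcurv).clm_apply hu).div (((hG.clm_apply hu).clm_apply hu).pow 2)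
    fun z hz => pow_ne_zero 2 (h.pos z.1 hz.1 z.2 hz.2).ne'

end Continuity

variable {M : Type*} [TopologicalSpace M] [ChartedSpace E M] [IsManifold 𝓘(ℂ, E) ω M]

theorem holSectionalAt_eq (g : SmoothMetric E M) (p : M) (u : E) :
    holSectionalAt g p u = holSectional (localMetric g (chartAt E p)) (chartAt E p p) u := rfl

variable [FiniteDimensional ℝ E]

/-- A vector in the kernel would have zero length for the pulled-back metric, which is the positive
definite metric of the chart `e`. -/
theorem bijective_fderiv_chart_change (g : SmoothMetric E M) {e e' : OpenPartialHomeomorph M E}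
    (he : e ∈ atlas E M) (he' : e' ∈ atlas E M) {y : E} (hy : y ∈ (e.symm.trans e').source) :
    Function.Bijective (fderiv ℝ (e' ∘ e.symm) y) := by
  have hy1 : y ∈ e.target ∧ e.symm y ∈ e'.source := by simpa using hy
  have hinj : Function.Injective (fderiv ℝ (e' ∘ e.symm) y) := by
    rw [injective_iff_map_eq_zero]
    intro u hu
    by_contra hne
    have h1 := (isMetricOn_localMetric g he).pos y hy1.1 u hne
    rw [localMetric_eq_pullback g he he' hy, pullbackMetric_apply, hu] at h1
    simp at h1
  exact ⟨hinj, LinearMap.surjective_of_injective (f := (fderiv ℝ (e' ∘ e.symm) y : E →ₗ[ℝ] E))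
    hinj⟩

/-- The holomorphic sectional curvature does not depend on the chart. -/
theorem holSectional_chart_change {g : SmoothMetric E M} (hK : IsKahler g)
    {e e' : OpenPartialHomeomorph M E} (he : e ∈ atlas E M) (he' : e' ∈ atlas E M) {y : E}
    (hy : y ∈ (e.symm.trans e').source) (u : E) :
    holSectional (localMetric g e) y u =
      holSectional (localMetric g e') (e' (e.symm y)) (fderiv ℝ (e' ∘ e.symm) y u) := by
  have hy1 : y ∈ e.target ∧ e.symm y ∈ e'.source := by simpa using hy
  have hV := (e.symm.trans e').open_source
  have hEq := localMetric_eq_pullback g he he'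
  rw [(isKahlerOn_localMetric hK he).holSectional_eq hy1.1,
    (isKahlerOn_localMetric hK he').holSectional_eq (e'.map_source hy1.2),
    curvature_congr hV hEq hy, hEq hy,
    (isKahlerOn_localMetric hK he').curvature_form_pullback hV
      ((contDiffOn_chart_change he he').restrict_scalars ℝ |>.of_le (by simp))
      (mapsTo_chart_change e e') (fun x hx => (bijective_fderiv_chart_change g he he' hx).1)
      (fun x hx => fderiv_chart_change_I he he' hx) hy, pullbackMetric_apply]
  rfl

/-- The Ricci tensor vanishes in every chart. -/
theorem ricci_localMetric_eq_zero [FiniteDimensional ℂ E] {g : SmoothMetric E M}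
    (hRic : IsRicciFlat g) {e : OpenPartialHomeomorph M E} (he : e ∈ atlas E M) {y : E}
    (hy : y ∈ e.target) (v w : E) : ricci (localMetric g e) y v w = 0 := by
  set e' := chartAt E (e.symm y)
  have he' : e' ∈ atlas E M := chart_mem_atlas E _
  have hyV : y ∈ (e.symm.trans e').source := by
    simpa using ⟨hy, mem_chart_source E (e.symm y)⟩
  have hV := (e.symm.trans e').open_source
  rw [ricci_congr hV (localMetric_eq_pullback g he he') hyV,
    (isMetricOn_localMetric g he').ricci_pullback hV
      ((contDiffOn_chart_change he he').restrict_scalars ℝ |>.of_le (by simp))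
      (mapsTo_chart_change e e') (fun x hx => (bijective_fderiv_chart_change g he he' hx).1) hyV]
  exact hRic (e.symm y) _ _

/-- `holSectionalAt` uses a chart that varies with the point; this compares it with one fixed chart,
through the derivative `Φ` of the chart change. -/
theorem holSectionalAt_symm {g : SmoothMetric E M} (hK : IsKahler g)
    {e : OpenPartialHomeomorph M E} (he : e ∈ atlas E M) {y : E} (hy : y ∈ e.target) :
    ∃ Φ : E →L[ℝ] E, Function.Bijective Φ ∧ ∀ u,
      holSectional (localMetric g e) y u = holSectionalAt g (e.symm y) (Φ u) := by
  have he' : chartAt E (e.symm y) ∈ atlas E M := chart_mem_atlas E _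
  have hyV : y ∈ (e.symm.trans (chartAt E (e.symm y))).source := by
    simpa using hy
  exact ⟨_, bijective_fderiv_chart_change g he he' hyV, fun u =>
    holSectional_chart_change hK he he' hyV u⟩

/-- Locally, the holomorphic sectional curvature attains a minimum over a neighbourhood. -/
theorem exists_local_min [Nontrivial E] {g : SmoothMetric E M} (hK : IsKahler g) (p : M) :
    ∃ N ∈ 𝓝 p, ∃ (q : M) (v : E), v ≠ 0 ∧
      ∀ q' ∈ N, ∀ v' : E, v' ≠ 0 → holSectionalAt g q v ≤ holSectionalAt g q' v' := by
  set e := chartAt E p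
  have he : e ∈ atlas E M := chart_mem_atlas E p
  have hp : p ∈ e.source := mem_chart_source E p
  have hKe := isKahlerOn_localMetric hK he
  obtain ⟨r, hr, hball⟩ := Metric.nhds_basis_closedBall.mem_iff.1
    (e.open_target.mem_nhds (e.map_source hp))
  have hcomp : IsCompact (Metric.closedBall (e p) r ×ˢ Metric.sphere (0 : E) 1) := by
    have : ProperSpace E := FiniteDimensional.proper ℝ E
    exact (isCompact_closedBall _ _).prod (isCompact_sphere _ _)
  have hsub : Metric.closedBall (e p) r ×ˢ Metric.sphere (0 : E) 1 ⊆ e.target ×ˢ {0}ᶜ := by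
    rintro ⟨y, u⟩ ⟨hy, hu⟩
    exact ⟨hball hy, ne_zero_of_mem_unit_sphere ⟨u, hu⟩⟩
  have hne : (Metric.closedBall (e p) r ×ˢ Metric.sphere (0 : E) 1).Nonempty := by
    obtain ⟨u, hu⟩ := NormedSpace.sphere_nonempty (x := (0 : E)).2 zero_le_one
    exact ⟨(e p, u), Metric.mem_closedBall_self hr.le, hu⟩
  -- The curvature is invariant under real scaling, so unit vectors suffice. The minimizer may lie
  -- over the boundary of the closed ball, so its base point need not belong to the open
  -- neighbourhood.
  obtain ⟨⟨y, u⟩, hyu, hmin⟩ := hcomp.exists_isMinOn hne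
    (hKe.continuousOn_holSectional.mono hsub)
  obtain ⟨Φ, hΦ, hΦe⟩ := holSectionalAt_symm hK he (hball hyu.1)
  refine ⟨e.source ∩ e ⁻¹' Metric.ball (e p) r,
    e.continuousOn.isOpen_inter_preimage e.open_source Metric.isOpen_ball |>.mem_nhds
      ⟨hp, Metric.mem_ball_self hr⟩, e.symm y, Φ u, ?_, ?_⟩
  · intro h0
    exact (hsub hyu).2 (hΦ.1 (h0.trans (map_zero Φ).symm))
  · rintro q' ⟨hq', hq'r⟩ v' hv'
    obtain ⟨Ψ, hΨ, hΨe⟩ := holSectionalAt_symm hK he (e.map_source hq')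
    obtain ⟨w, rfl⟩ := hΨ.2 v'
    have hw : w ≠ 0 := by
      rintro rfl
      exact hv' (map_zero Ψ)
    have hw' : ‖w‖⁻¹ ≠ 0 := inv_ne_zero (norm_ne_zero_iff.2 hw)
    rw [← hΦe, ← congrArg (fun q => holSectionalAt g q (Ψ w)) (e.left_inv hq'), ← hΨe,
      ← hKe.holSectional_smul (e.map_source hq') hw' w]
    refine hmin (a := (e q', ‖w‖⁻¹ • w)) ⟨Metric.ball_subset_closedBall hq'r, ?_⟩
    rw [mem_sphere_zero_iff_norm, norm_smul, norm_inv, norm_norm,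
      inv_mul_cancel₀ (norm_ne_zero_iff.2 hw)]

/-- Without boundedness the supremum in `Hmax` would be the default value `0` and would bound
nothing. -/
theorem bddAbove_holSectionalAt {g : SmoothMetric E M} (hK : IsKahler g) (p : M) :
    BddAbove {h | ∃ u : E, u ≠ 0 ∧ holSectionalAt g p u = h} := by
  set e := chartAt E p
  have he : e ∈ atlas E M := chart_mem_atlas E p
  have hp : e p ∈ e.target := e.map_source (mem_chart_source E p)
  have hKe := isKahlerOn_localMetric hK he
  have hcomp : IsCompact ({e p} ×ˢ Metric.sphere (0 : E) 1) := by
    have : ProperSpace E := FiniteDimensional.proper ℝ E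
    exact isCompact_singleton.prod (isCompact_sphere _ _)
  have hsub : {e p} ×ˢ Metric.sphere (0 : E) 1 ⊆ e.target ×ˢ {0}ᶜ := by
    rintro ⟨y, u⟩ ⟨rfl, hu⟩
    exact ⟨hp, ne_zero_of_mem_unit_sphere ⟨u, hu⟩⟩
  obtain ⟨C, hC⟩ := hcomp.bddAbove_image (hKe.continuousOn_holSectional.mono hsub)
  refine ⟨C, ?_⟩
  rintro _ ⟨u, hu, rfl⟩
  have hu' : ‖u‖⁻¹ ≠ 0 := inv_ne_zero (norm_ne_zero_iff.2 hu)
  rw [holSectionalAt_eq, ← hKe.holSectional_smul hp hu' u]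
  refine hC ⟨(e p, ‖u‖⁻¹ • u), ⟨rfl, ?_⟩, rfl⟩
  rw [mem_sphere_zero_iff_norm, norm_smul, norm_inv, norm_norm,
    inv_mul_cancel₀ (norm_ne_zero_iff.2 hu)]

/-- On a compact manifold the holomorphic sectional curvature attains its minimum. -/
theorem exists_global_min [Nontrivial E] [CompactSpace M] [Nonempty M] {g : SmoothMetric E M}
    (hK : IsKahler g) : ∃ (q : M) (v : E), v ≠ 0 ∧
      ∀ (q' : M) (v' : E), v' ≠ 0 → holSectionalAt g q v ≤ holSectionalAt g q' v' := by
  choose N hN q v hv hmin using exists_local_min (E := E) hK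
  obtain ⟨t, -, ht⟩ := isCompact_univ.elim_nhds_subcover N fun p _ => hN p
  have htne : t.Nonempty := by
    obtain ⟨p⟩ := ‹Nonempty M›
    obtain ⟨i, hi, -⟩ := Set.mem_iUnion₂.1 (ht (Set.mem_univ p))
    exact ⟨i, hi⟩
  obtain ⟨i, -, hi⟩ := t.exists_min_image (fun p => holSectionalAt g (q p) (v p)) htne
  refine ⟨q i, v i, hv i, fun q' v' hv' => ?_⟩
  obtain ⟨j, hj, hq'⟩ := Set.mem_iUnion₂.1 (ht (Set.mem_univ q'))
  exact (hi j hj).trans (hmin j q' hq' v' hv')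

end Transfer

end

/-! ### Conclusion. -/

theorem theorem1p2 {E : Type*} [NormedAddCommGroup E] [NormedSpace ℂ E]
    [FiniteDimensional ℂ E] (hE : Module.finrank ℂ E = 2)
    {M : Type*} [TopologicalSpace M] [T2Space M] [CompactSpace M]
    [ChartedSpace E M] [IsManifold 𝓘(ℂ, E) ω M]
    (g : SmoothMetric E M) (hK : IsKahler g) (hRic : IsRicciFlat g)
    (c : ℝ) (hc0 : 0 ≤ c) (hc : c < (1 + √3) / 2)
    (hpinch : ∀ p : M, Hmax g p ≤ -c * Hmin g p) :
    IsFlat g := by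
  intro p
  have : Nonempty M := ⟨p⟩
  have : Nontrivial E := Module.nontrivial_of_finrank_pos (R := ℂ) (by rw [hE]; norm_num)
  obtain ⟨u₀, hu₀⟩ := exists_ne (0 : E)
  obtain ⟨q, v, hv, hmin⟩ := exists_global_min hK
  set m := holSectionalAt g q v with hm
  have hmax : ∀ (p : M) (u : E), u ≠ 0 → holSectionalAt g p u ≤ -c * Hmin g p := fun p u hu =>
    (le_csSup (bddAbove_holSectionalAt hK p) ⟨u, hu, rfl⟩).trans (hpinch p)
  have hHmin : ∀ p : M, m ≤ Hmin g p := fun p =>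
    le_csInf ⟨_, u₀, hu₀, rfl⟩ (by rintro _ ⟨u, hu, rfl⟩; exact hmin p u hu)
  have hKahler := fun p : M => isKahlerOn_localMetric hK (chart_mem_atlas E p)
  have hpt := fun p : M => (chartAt E p).map_source (mem_chart_source E p)
  -- A negative minimum is excluded by the maximum principle; otherwise the pinching makes all
  -- holomorphic sectional curvatures zero.
  rcases lt_or_ge m 0 with hneg | hnonneg
  · exfalso
    -- At the minimizing point `Hmin` equals the global minimum `m`, so the pinching there has the
    -- form `-c * m`.
    have hHq : Hmin g q ≤ m := csInf_le ⟨m, by rintro _ ⟨u, hu, rfl⟩; exact hmin q u hu⟩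
      ⟨v, hv, rfl⟩
    refine (hKahler q).false_of_pinched_min hE
      (fun y hy => ricci_localMetric_eq_zero hRic (chart_mem_atlas E q) hy) hneg hc0 hc
      (fun y hy u => ?_) (hpt q) hv ?_ (fun u => ?_)
    · rcases eq_or_ne u 0 with rfl | hu
      · simp
      · obtain ⟨Φ, hΦ, hΦe⟩ := holSectionalAt_symm hK (chart_mem_atlas E q) hy
        have h1 := hmin ((chartAt E q).symm y) (Φ u)
          fun h0 => hu (hΦ.1 (h0.trans (map_zero Φ).symm))
        rwa [← hΦe, (hKahler q).holSectional_eq hy,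
          le_div_iff₀ (pow_pos ((hKahler q).pos y hy u hu) 2)] at h1
    · have h1 := hm
      rw [holSectionalAt_eq, (hKahler q).holSectional_eq (hpt q),
        eq_div_iff (pow_pos ((hKahler q).pos _ (hpt q) v hv) 2).ne'] at h1
      exact h1.symm
    · rcases eq_or_ne u 0 with rfl | hu
      · simp
      · have h1 := hmax q u hu
        rw [le_antisymm hHq (hHmin q), holSectionalAt_eq, (hKahler q).holSectional_eq (hpt q),
          div_le_iff₀ (pow_pos ((hKahler q).pos _ (hpt q) u hu) 2)] at h1
        exact h1
  · refine (hKahler p).curvature_eq_zero_of_holomorphic hE (hpt p) (hRic p) fun u => ?_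
    rcases eq_or_ne u 0 with rfl | hu
    · simp
    · have h1 : holSectionalAt g p u = 0 := by
        refine le_antisymm ((hmax p u hu).trans ?_) (hnonneg.trans (hmin p u hu))
        have := mul_nonneg hc0 (hnonneg.trans (hHmin p))
        linarith
      rw [holSectionalAt_eq, (hKahler p).holSectional_eq (hpt p), div_eq_zero_iff] at h1
      exact h1.resolve_right (pow_pos ((hKahler p).pos _ (hpt p) u hu) 2).ne'
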